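/- Let $\mathbb F_q$ be a finite field of odd characteristic and let $n\ge 1$. Index the rows and columns of $2n\times 2n$ matrices by $1,2,\dots,n,-n,\dots,-2,-1$ (in this order), and let $e_{a,b}$ be the elementary matrices. Let $$\Phi^+=\{\varepsilon_i\pm\varepsilon_j : 1\le i<j\le n\}\cup\{2\varepsilon_i : 1\le i\le n\}\subset\mathbb R^n$$ be the set of positive roots of type $C_n$, where $\varepsilon_1,\dots,\varepsilon_n$ is the standard basis of $\mathbb R^n$, and put $$e_{2\varepsilon_i}=e_{-i,i},\qquad e_{\varepsilon_i-\varepsilon_j}=e_{j,i}-e_{-i,-j},\qquad e_{\varepsilon_i+\varepsilon_j}=e_{-j,i}+e_{-i,j}\qquad(i<j).$$ Let $\mathfrak u$ be the $\mathbb F_q$-span of all $e_\alpha$, $\alpha\in\Phi^+$ (a maximal nilpotent subalgebra of $\mathfrak{sp}_{2n}(\mathbb F_q)$), let $(e_\alpha^*)_{\alpha\in\Phi^+}$ be the dual basis of $\mathfrak u^*$, and let $U$ be the corresponding maximal unipotent subgroup of $\mathrm{Sp}_{2n}(\mathbb F_q)$, that is, the group of all symplectic matrices that are lower triangular with ones on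 the diagonal with respect to the above order of indices. The group $U$ acts on $\mathfrak u^*$ by the coadjoint action $(g.f)(x)=f(g^{-1}xg)$. The dimension $\dim\Omega$ of a coadjoint orbit $\Omega\subset\mathfrak u^*$ is the integer defined by $|\Omega|=q^{\dim\Omega}$. Put $D_{\mathrm{reg}}=\{2\varepsilon_i : 1\le i\le n\}\cup\{\varepsilon_i+\varepsilon_{i+1} : 1\le i\le n-1\}$. Consider the linear forms $$f_{D,\xi}=\sum_{\beta\in D}\xi_\beta e_\beta^*\in\mathfrak u^*,\qquad(\ast)$$ where $D$ is a subset of $D_{\mathrm{reg}}$ that is maximal with respect to inclusion among the subsets of $D_{\mathrm{reg}}$ consisting of pairwise orthogonal roots, and $\xi=(\xi_\beta)_{\beta\in D}$ is a family of elements of $\mathbb F_q$ such that $\xi_\beta\neq 0$ for all $\beta\in D\setminus\{2\varepsilon_n\}$ (if $2\varepsilon_n\in D$, then $\xi_{2\varepsilon_n}$ is arbitrary, possibly zero). **Theorem.** Every coadjoint orbit of $U$ has a dimension, which is at most $n(n-1)$. For every form $f_{D,\xi}$ as in $(\ast)$, its coadjoint orbit has dimension $n(n-1)$, the maximal dimension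 of a coadjoint orbit. Conversely, every coadjoint orbit of maximal dimension contains exactly one linear form of the form $(\ast)$. -/

import Mathlib

open Matrix

namespace TypeC

/-- Positive roots of type `C_n`; `Fin n` plays the role of `{1, …, n}`. -/
inductive PosRoot (n : ℕ) : Type
  /-- the root `2 ε_i` -/
  | long (i : Fin n) : PosRoot n
  /-- the root `ε_i - ε_j`, `i < j` -/
  | sub (i j : Fin n) (h : i < j) : PosRoot n
  /-- the root `ε_i + ε_j`, `i < j` -/
  | add (i j : Fin n) (h : i < j) : PosRoot n

/-- The root as a vector of `ℝ^n`, where `ε_i = Pi.single i 1` is the standard basis. -/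
def PosRoot.toVec {n : ℕ} : PosRoot n → (Fin n → ℝ)
  | .long i => (2 : ℝ) • Pi.single i 1
  | .sub i j _ => Pi.single i 1 - Pi.single j 1
  | .add i j _ => Pi.single i 1 + Pi.single j 1

/-- Orthogonality of roots for the standard inner product of `ℝ^n`. -/
def PosRoot.Orthogonal {n : ℕ} (α β : PosRoot n) : Prop :=
  α.toVec ⬝ᵥ β.toVec = 0

/-- The set `D_reg = {2ε_1, …, 2ε_n, ε_1 + ε_2, …, ε_{n-1} + ε_n}`. -/
def Dreg (n : ℕ) : Set (PosRoot n) :=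
  {β | (∃ i, β = .long i) ∨ ∃ (i j : Fin n) (h : i < j), (i : ℕ) + 1 = j ∧ β = .add i j h}

/-- `D` is a subset of `D_reg` consisting of pairwise orthogonal roots. -/
def IsOrthogonalSubset {n : ℕ} (D : Finset (PosRoot n)) : Prop :=
  (D : Set (PosRoot n)) ⊆ Dreg n ∧ (D : Set (PosRoot n)).Pairwise PosRoot.Orthogonal

/-- `D` is maximal, with respect to inclusion, among the orthogonal subsets of `D_reg`. -/
def IsMaximalOrthogonal {n : ℕ} (D : Finset (PosRoot n)) : Prop :=
  Maximal IsOrthogonalSubset D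

/-- The position of an index in the order `1 ≺ 2 ≺ … ≺ n ≺ -n ≺ … ≺ -2 ≺ -1`.  The index `i` is
`Sum.inl i` and the index `-i` is `Sum.inr i`. -/
def pos {n : ℕ} : Fin n ⊕ Fin n → ℕ
  | .inl i => i
  | .inr i => 2 * n - 1 - i

variable (F : Type*) [Field F] {n : ℕ}

/-- The root vectors `e_{2ε_i} = e_{-i,i}`, `e_{ε_i-ε_j} = e_{j,i} - e_{-i,-j}`,
`e_{ε_i+ε_j} = e_{-j,i} + e_{-i,j}`. -/
def rootVec : PosRoot n → Matrix (Fin n ⊕ Fin n) (Fin n ⊕ Fin n) F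
  | .long i => Matrix.single (.inr i) (.inl i) 1
  | .sub i j _ => Matrix.single (.inl j) (.inl i) 1 - Matrix.single (.inr i) (.inr j) 1
  | .add i j _ => Matrix.single (.inr j) (.inl i) 1 + Matrix.single (.inr i) (.inl j) 1

variable (n) in
/-- The Lie algebra `𝔲`, the linear span of the root vectors of all positive roots. -/
def nilp : Submodule F (Matrix (Fin n ⊕ Fin n) (Fin n ⊕ Fin n) F) :=
  Submodule.span F (Set.range (rootVec F))

variable {F}

theorem swap_pos (a b : Fin n ⊕ Fin n) : pos a.swap < pos b.swap ↔ pos b < pos a := by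
  rcases a with a | a <;> rcases b with b | b <;> simp [pos] <;> omega

theorem pos_injective : Function.Injective (pos (n := n)) := by
  intro a b h
  rcases a with a | a <;> rcases b with b | b <;> simp [pos] at h ⊢ <;> omega

theorem mem_sp_iff {X : Matrix (Fin n ⊕ Fin n) (Fin n ⊕ Fin n) F} :
    X ∈ LieAlgebra.Symplectic.sp (Fin n) F ↔ Xᵀ * J (Fin n) F = -(J (Fin n) F * X) := by
  simp [LieAlgebra.Symplectic.sp, Matrix.IsSkewAdjoint, Matrix.IsAdjointPair]

theorem mem_sp_iff_apply {X : Matrix (Fin n ⊕ Fin n) (Fin n ⊕ Fin n) F} :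
    X ∈ LieAlgebra.Symplectic.sp (Fin n) F ↔
      (∀ a b, X (.inr a) (.inr b) = -X (.inl b) (.inl a)) ∧
      (∀ a b, X (.inr a) (.inl b) = X (.inr b) (.inl a)) ∧
      (∀ a b, X (.inl a) (.inr b) = X (.inl b) (.inr a)) := by
  rw [mem_sp_iff]
  have key : ∀ a b, (Xᵀ * J (Fin n) F) a b = (-(J (Fin n) F * X)) a b ↔
      (match a, b with
        | .inl i, .inl j => X (.inr j) (.inl i) = X (.inr i) (.inl j)
        | .inl i, .inr j => X (.inr i) (.inr j) = -X (.inl j) (.inl i)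
        | .inr i, .inl j => X (.inr j) (.inr i) = -X (.inl i) (.inl j)
        | .inr i, .inr j => X (.inl j) (.inr i) = X (.inl i) (.inr j)) := by
    rintro (a | a) (b | b) <;>
      simp [Matrix.J, Matrix.mul_apply, Matrix.fromBlocks, Matrix.one_apply] <;> grind
  rw [← Matrix.ext_iff]
  simp only [key]
  constructor
  · intro h
    exact ⟨fun a b => h (.inl a) (.inr b), fun a b => h (.inl b) (.inl a),
      fun a b => h (.inr b) (.inr a)⟩
  · rintro ⟨hA, hC, hB⟩ (a | a) (b | b)
    exacts [hC b a, hA a b, hA b a, hB b a]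

/-- `𝔲` consists of the strictly lower triangular matrices (for the order
`1 ≺ … ≺ n ≺ -n ≺ … ≺ -1`) in the symplectic Lie algebra. -/
theorem mem_nilp_iff {X : Matrix (Fin n ⊕ Fin n) (Fin n ⊕ Fin n) F} :
    X ∈ nilp F n ↔
      X ∈ LieAlgebra.Symplectic.sp (Fin n) F ∧ ∀ a b, pos a ≤ pos b → X a b = 0 := by
  constructor
  · intro hX
    induction hX using Submodule.span_induction with
    | mem x hx =>
      obtain ⟨α, rfl⟩ := hx
      rw [mem_sp_iff_apply]
      rcases α with i | ⟨i, j, h⟩ | ⟨i, j, h⟩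
      all_goals
        refine ⟨⟨?_, ?_, ?_⟩, ?_⟩
        · intro a b
          simp [rootVec, Matrix.single_apply, and_comm]
        · intro a b
          simp [rootVec, Matrix.single_apply, and_comm, add_comm]
        · intro a b
          simp [rootVec, Matrix.single_apply]
        · intro a b hab
          rcases a with a | a <;> rcases b with b | b <;>
            simp [rootVec, Matrix.single_apply, pos] at hab ⊢ <;> grind
    | zero => exact ⟨zero_mem _, fun _ _ _ => rfl⟩
    | add x y _ _ hx hy =>
      exact ⟨add_mem hx.1 hy.1, fun a b h => by simp [hx.2 a b h, hy.2 a b h]⟩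
    | smul c x _ hx =>
      obtain ⟨h1, h2⟩ := hx
      refine ⟨?_, fun a b h => by simp [h2 a b h]⟩
      rw [mem_sp_iff] at h1 ⊢
      simp [h1]
  · rintro ⟨h1, h2⟩
    rw [mem_sp_iff_apply] at h1
    obtain ⟨hA, hC, hB⟩ := h1
    have key : X = ∑ i, X (.inr i) (.inl i) • rootVec F (.long i) +
        ∑ i, ∑ j, if h : i < j then X (.inl j) (.inl i) • rootVec F (.sub i j h) +
          X (.inr j) (.inl i) • rootVec F (.add i j h) else 0 := by
      have e : ∀ i j : Fin n, (if h : i < j then X (.inl j) (.inl i) • rootVec F (.sub i j h) +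
          X (.inr j) (.inl i) • rootVec F (.add i j h) else 0) =
          Matrix.single (.inl j) (.inl i) (if i < j then X (.inl j) (.inl i) else 0) -
          Matrix.single (.inr i) (.inr j) (if i < j then X (.inl j) (.inl i) else 0) +
          Matrix.single (.inr j) (.inl i) (if i < j then X (.inr j) (.inl i) else 0) +
          Matrix.single (.inr i) (.inl j) (if i < j then X (.inr j) (.inl i) else 0) := by
        intro i j
        split_ifs with h
        · simp [rootVec, smul_add, smul_sub, Matrix.smul_single]
          abel
        · simp
      simp only [e]
      ext a b
      rcases a with a | a <;> rcases b with b | b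
      · simp [rootVec, Matrix.sum_apply, Matrix.single_apply, ite_and]
        exact fun h => h2 _ _ (by simpa [pos] using h)
      · simp [rootVec, Matrix.sum_apply]
        exact h2 _ _ (by simp [pos]; omega)
      · simp [rootVec, Matrix.sum_apply, Matrix.single_apply, ite_and, Finset.sum_add_distrib]
        rcases lt_trichotomy a b with h | h | h
        · simp [h, h.ne, hC a b, not_lt.2 h.le]
        · simp [h]
        · simp [h, h.ne', not_lt.2 h.le]
      · simp [rootVec, Matrix.sum_apply, Matrix.single_apply, ite_and, hA a b]
        exact fun h => h2 _ _ (by simpa [pos] using h)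
    rw [key]
    refine add_mem (Submodule.sum_mem _ fun i _ => ?_)
      (Submodule.sum_mem _ fun i _ => Submodule.sum_mem _ fun j _ => ?_)
    · exact Submodule.smul_mem _ _ (Submodule.subset_span ⟨_, rfl⟩)
    · split_ifs with h
      · exact add_mem (Submodule.smul_mem _ _ (Submodule.subset_span ⟨_, rfl⟩))
          (Submodule.smul_mem _ _ (Submodule.subset_span ⟨_, rfl⟩))
      · exact zero_mem _

theorem inv_apply_inl (g : symplecticGroup (Fin n) F) (a b : Fin n) :
    (g⁻¹).1 (.inl a) (.inl b) = g.1 (.inr b) (.inr a) := by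
  simp [SymplecticGroup.coe_inv, Matrix.J, Matrix.mul_apply, Matrix.fromBlocks, Matrix.one_apply]

theorem inv_apply_inr (g : symplecticGroup (Fin n) F) (a b : Fin n) :
    (g⁻¹).1 (.inr a) (.inr b) = g.1 (.inl b) (.inl a) := by
  simp [SymplecticGroup.coe_inv, Matrix.J, Matrix.mul_apply, Matrix.fromBlocks, Matrix.one_apply]

theorem inv_apply_eq (g : symplecticGroup (Fin n) F) (a b : Fin n ⊕ Fin n) :
    (g⁻¹).1 a b = g.1 b.swap a.swap ∨ (g⁻¹).1 a b = -g.1 b.swap a.swap := by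
  rcases a with a | a <;> rcases b with b | b <;>
  simp [SymplecticGroup.coe_inv, Matrix.J, Matrix.mul_apply, Matrix.fromBlocks, Matrix.one_apply]

variable (F n) in
/-- The maximal unipotent subgroup `U` of the symplectic group: the symplectic matrices that are
lower triangular with ones on the diagonal, for the order `1 ≺ … ≺ n ≺ -n ≺ … ≺ -1`. -/
def unip : Subgroup (symplecticGroup (Fin n) F) where
  carrier := {g | (∀ a b, pos a < pos b → g.1 a b = 0) ∧ ∀ a, g.1 a a = 1}
  one_mem' := by
    refine ⟨fun a b h => ?_, fun a => by simp⟩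
    have : a ≠ b := by rintro rfl; exact lt_irrefl _ h
    simp [this]
  mul_mem' := by
    rintro g h ⟨hg, hg1⟩ ⟨hh, hh1⟩
    refine ⟨fun a b hab => ?_, fun a => ?_⟩
    · change (g.1 * h.1) a b = 0
      rw [Matrix.mul_apply]
      refine Finset.sum_eq_zero fun c _ => ?_
      rcases lt_or_ge (pos a) (pos c) with hc | hc
      · rw [hg a c hc, zero_mul]
      · rw [hh c b (hc.trans_lt hab), mul_zero]
    · change (g.1 * h.1) a a = 1
      rw [Matrix.mul_apply, Finset.sum_eq_single a, hg1, hh1, mul_one]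
      · intro c _ hc
        rcases lt_or_ge (pos a) (pos c) with hac | hac
        · rw [hg a c hac, zero_mul]
        · rw [hh c a (lt_of_le_of_ne hac fun h => hc (pos_injective h)), mul_zero]
      · simp
  inv_mem' := by
    rintro g ⟨hg, hg1⟩
    refine ⟨fun a b hab => ?_, fun a => ?_⟩
    · rcases inv_apply_eq g a b with h | h <;> rw [h, hg _ _ ((swap_pos _ _).2 hab)]
      simp
    · rcases a with a | a
      · rw [inv_apply_inl, hg1]
      · rw [inv_apply_inr, hg1]

theorem conj_mem_nilp (g : unip F n) {X : Matrix (Fin n ⊕ Fin n) (Fin n ⊕ Fin n) F}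
    (hX : X ∈ nilp F n) : g.1.1 * X * (g⁻¹).1.1 ∈ nilp F n := by
  rw [mem_nilp_iff] at hX ⊢
  obtain ⟨h1, h2⟩ := hX
  constructor
  · rw [mem_sp_iff] at h1 ⊢
    have hJ : J (Fin n) F * J (Fin n) F = -1 := J_squared _ _
    have e1 : (g.1.1)ᵀ * J (Fin n) F = J (Fin n) F * (g⁻¹).1.1 := by
      change _ = _ * ((g.1)⁻¹).1
      rw [SymplecticGroup.coe_inv, mul_assoc, ← mul_assoc (J _ _), Matrix.mul_neg, hJ]
      simp
    have e2 : ((g⁻¹).1.1)ᵀ * J (Fin n) F = J (Fin n) F * g.1.1 := by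
      change (((g.1)⁻¹).1)ᵀ * _ = _
      rw [SymplecticGroup.coe_inv]
      simp only [transpose_mul, transpose_neg, J_transpose, transpose_transpose, neg_neg,
        mul_assoc, hJ]
      simp
    rw [transpose_mul, transpose_mul, mul_assoc, mul_assoc, e1, ← mul_assoc Xᵀ, h1,
      Matrix.neg_mul, Matrix.mul_neg, ← mul_assoc, ← mul_assoc, e2]
    simp only [mul_assoc]
  · intro a b hab
    rw [Matrix.mul_apply]
    refine Finset.sum_eq_zero fun d _ => ?_
    rcases lt_or_ge (pos d) (pos b) with hd | hd
    · rw [(g⁻¹).2.1 d b hd, mul_zero]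
    · rw [Matrix.mul_apply, Finset.sum_eq_zero, zero_mul]
      intro c _
      rcases lt_or_ge (pos a) (pos c) with hc | hc
      · rw [g.2.1 a c hc, zero_mul]
      · rw [h2 c d (hc.trans (hab.trans hd)), mul_zero]

variable (F n) in
/-- The adjoint action `g ↦ (X ↦ g X g⁻¹)` of `U` on `𝔲`. -/
def adjointRep : Representation F (unip F n) (nilp F n) where
  toFun g :=
    { toFun := fun X => ⟨g.1.1 * X.1 * (g⁻¹).1.1, conj_mem_nilp g X.2⟩
      map_add' := fun X Y => Subtype.ext (by simp [mul_add, add_mul])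
      map_smul' := fun c X => Subtype.ext (by simp) }
  map_one' := by
    ext X : 2
    simp
  map_mul' g h := by
    ext X : 2
    simp [mul_assoc, _root_.mul_inv_rev]

variable (F n) in
/-- The coadjoint action of `U` on the dual space `𝔲*`, `(g.f)(X) = f(g⁻¹ X g)`. -/
def coadjointRep : Representation F (unip F n) (Module.Dual F (nilp F n)) :=
  (adjointRep F n).dual

/-- The coadjoint orbit of a linear form. -/
def coadjointOrbit (f : Module.Dual F (nilp F n)) : Set (Module.Dual F (nilp F n)) :=
  Set.range fun g : unip F n => coadjointRep F n g f

/-- `Ω` is a coadjoint orbit. -/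
def IsCoadjointOrbit (Ω : Set (Module.Dual F (nilp F n))) : Prop :=
  ∃ f, Ω = coadjointOrbit f

/-- `dim Ω = d`: over the finite field with `q` elements this means `|Ω| = q ^ d` (here `Ω` is the set
of rational points of an affine variety, whose dimension is determined by this equation). -/
def HasDim (Ω : Set (Module.Dual F (nilp F n))) (d : ℕ) : Prop :=
  Nat.card Ω = Nat.card F ^ d

/-- `Ω` is a coadjoint orbit whose dimension is the largest among all coadjoint orbits. -/
def IsMaxDimOrbit (Ω : Set (Module.Dual F (nilp F n))) : Prop :=
  IsCoadjointOrbit Ω ∧ ∃ d, HasDim Ω d ∧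
    ∀ Ω' : Set (Module.Dual F (nilp F n)), IsCoadjointOrbit Ω' → ∀ d', HasDim Ω' d' → d' ≤ d

/-- The scalar `1` for long roots and `1/2` for short ones, so that the trace pairing of
`coeff α • (e_α)ᵀ` with `e_α` is `1`. -/
def PosRoot.coeff : PosRoot n → F
  | .long _ => 1
  | .sub _ _ _ => 2⁻¹
  | .add _ _ _ => 2⁻¹

/-- The linear form `e_α^*` on `𝔲`: the trace pairing with `(e_α)ᵀ` for a long root `α`, and with
`(e_α)ᵀ / 2` for a short one. -/
def dualVec (α : PosRoot n) : Module.Dual F (nilp F n) :=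
  (Matrix.traceLinearMap _ F F ∘ₗ
    LinearMap.mulLeft F ((α.coeff : F) • (rootVec F α)ᵀ)) ∘ₗ (nilp F n).subtype

theorem rootVec_mem (α : PosRoot n) : rootVec F α ∈ nilp F n :=
  Submodule.subset_span ⟨α, rfl⟩

open Classical in
/-- In odd characteristic, the forms `e_α^*` are dual to the basis of root vectors. -/
theorem dualVec_rootVec (h2 : (2 : F) ≠ 0) (α β : PosRoot n) :
    dualVec α ⟨rootVec F β, rootVec_mem β⟩ = if α = β then 1 else 0 := by
  rcases α with i | ⟨i, j, h⟩ | ⟨i, j, h⟩ <;> rcases β with k | ⟨k, l, h'⟩ | ⟨k, l, h'⟩ <;>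
    simp [dualVec, rootVec, PosRoot.coeff, Matrix.mul_add, Matrix.add_mul, Matrix.mul_sub,
      Matrix.sub_mul, Matrix.trace_single_mul, Matrix.single_apply, h2] <;> grind

/-- The linear form `f_{D,ξ} = ∑_{β ∈ D} ξ_β e_β^*`; only the values of `ξ` on `D` matter. -/
def canonicalForm (D : Finset (PosRoot n)) (ξ : PosRoot n → F) : Module.Dual F (nilp F n) :=
  ∑ β ∈ D, ξ β • dualVec β

/-- The constants `ξ_β`, `β ∈ D`, are nonzero, except that `ξ_{2ε_n}` is allowed to be zero. -/
def IsAdmissible (D : Finset (PosRoot n)) (ξ : PosRoot n → F) : Prop :=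
  ∀ β ∈ D, (∀ i : Fin n, (i : ℕ) + 1 = n → β ≠ .long i) → ξ β ≠ 0

end TypeC

/-! Write an element of `nilp` in block form with diagonal blocks `A`, `-Aᵀ`, upper right block `0`
and lower left block `S`, where `A` is strictly lower triangular and `S` symmetric. The elements
with `A = 0` form an abelian ideal `𝔞` (`siegelIdeal`) of codimension `n(n-1)/2`.

Dimension. Let `B_f(X, Y) = f([X, Y])` (`kirillovForm`). The Cayley transform maps the kernel of
`B_f` bijectively onto the stabilizer of `f`, so the orbit of `f` has `q ^ rank B_f` elements
(`hasDim_coadjointOrbit`). Since `𝔞` is abelian, it is totally isotropic for `B_f`; hence `rank B_f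
≤ 2 codim 𝔞 = n(n-1)`, with equality exactly when `𝔞` is its own orthogonal complement.

Reduction to matrices. The restriction of `f` to `𝔞` is a symmetric matrix `Q` (`quadPart`). In
terms of `Q`, self-orthogonality of `𝔞` says that no nonzero strictly lower triangular `A` makes
`AQ` skew-symmetric (`IsRegular`). In that case `B_f(𝔞)` is the whole annihilator of `𝔞`, so the
unipotent elements attached to `𝔞` carry `f` to every form with the same `Q`. As `U` acts on `Q` by
congruence with arbitrary unit lower triangular matrices, the orbits of maximal dimension correspond
to the congruence classes of regular symmetric matrices.

Classification. For regular `Q`, symmetric elimination always finds a pivot in position `(m, m)` or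
`(m, m+1)` (`IsRegular.exists_pivot`) and ends in a block diagonal matrix with blocks of size one
and antidiagonal blocks of size two (`IsRegular.exists_isCanonical`). Congruent matrices of this
shape are equal (`IsCanonical.eq_of_congruent`), and they are precisely the matrices `Q` of the
forms `f_{D,ξ}`. The last diagonal entry may be zero, which accounts for the exception at `2ε_n`. -/

namespace TypeC

/-! ### Triangular matrices with respect to an injective ordering of the indices. -/

section Triangular

variable {ι R : Type*}

/-- Matrices vanishing above and on the diagonal, for the order given by `p`. -/
def IsStrictLower [Zero R] (p : ι → ℕ) (A : Matrix ι ι R) : Prop :=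
  ∀ i j, p i ≤ p j → A i j = 0

/-- Lower triangular matrices with ones on the diagonal, for the order given by `p`. -/
def IsUnitLower [Zero R] [One R] (p : ι → ℕ) (a : Matrix ι ι R) : Prop :=
  (∀ i j, p i < p j → a i j = 0) ∧ ∀ i, a i i = 1

/-- Lower triangular matrices, for the order given by `p`. -/
def IsLower [Zero R] (p : ι → ℕ) (a : Matrix ι ι R) : Prop :=
  ∀ i j, p i < p j → a i j = 0

theorem IsStrictLower.isLower [Zero R] {p : ι → ℕ} {A : Matrix ι ι R} (h : IsStrictLower p A) :
    IsLower p A := fun i j hij => h i j hij.le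

theorem IsUnitLower.isLower [Zero R] [One R] {p : ι → ℕ} {A : Matrix ι ι R}
    (h : IsUnitLower p A) : IsLower p A := h.1

theorem IsLower.add [AddZeroClass R] {p : ι → ℕ} {A B : Matrix ι ι R} (hA : IsLower p A)
    (hB : IsLower p B) : IsLower p (A + B) := fun i j h => by simp [hA i j h, hB i j h]

variable [Field R] {p : ι → ℕ}

theorem isLower_one [DecidableEq ι] : IsLower p (1 : Matrix ι ι R) := by
  intro i j h
  exact Matrix.one_apply_ne (by rintro rfl; exact lt_irrefl _ h)

theorem IsStrictLower.mul_isLower [Fintype ι] {A B : Matrix ι ι R} (hA : IsStrictLower p A)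
    (hB : IsLower p B) : IsStrictLower p (A * B) := by
  intro i j hij
  rw [Matrix.mul_apply]
  refine Finset.sum_eq_zero fun k _ => ?_
  rcases le_or_gt (p i) (p k) with h | h
  · rw [hA i k h, zero_mul]
  · rw [hB k j (h.trans_le hij), mul_zero]

theorem IsLower.mul_isStrictLower [Fintype ι] {A B : Matrix ι ι R} (hA : IsLower p A)
    (hB : IsStrictLower p B) : IsStrictLower p (A * B) := by
  intro i j hij
  rw [Matrix.mul_apply]
  refine Finset.sum_eq_zero fun k _ => ?_
  rcases lt_or_ge (p i) (p k) with h | h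
  · rw [hA i k h, zero_mul]
  · rw [hB k j (h.trans hij), mul_zero]

theorem isUnitLower_iff [DecidableEq ι] (hp : p.Injective) {a : Matrix ι ι R} :
    IsUnitLower p a ↔ IsStrictLower p (a - 1) := by
  constructor
  · rintro ⟨h1, h2⟩ i j hij
    by_cases h : i = j
    · subst h; simp [h2]
    · simp [Matrix.one_apply_ne h, h1 i j (lt_of_le_of_ne hij fun e => h (hp e))]
  · intro h
    refine ⟨fun i j hij => ?_, fun i => ?_⟩
    · have := h i j hij.le
      rwa [Matrix.sub_apply, Matrix.one_apply_ne (by rintro rfl; exact lt_irrefl _ hij),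
        sub_zero] at this
    · have := h i i le_rfl
      rwa [Matrix.sub_apply, Matrix.one_apply_eq, sub_eq_zero] at this

variable [Fintype ι] [DecidableEq ι]

theorem IsLower.isUnit_det (hp : p.Injective) {a : Matrix ι ι R} (ha : IsLower p a)
    (h : ∀ i, a i i ≠ 0) : IsUnit a.det := by
  have hb : Matrix.BlockTriangular a (OrderDual.toDual ∘ p) := fun i j hij => ha i j hij
  rw [hb.det, isUnit_iff_ne_zero, Finset.prod_ne_zero_iff]
  intro k hk
  obtain ⟨i, -, rfl⟩ := Finset.mem_image.1 hk
  -- Injectivity of `p` makes all diagonal blocks of size one, so the determinant is the product of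
  -- the diagonal entries.
  have : Subsingleton {j // (OrderDual.toDual ∘ p) j = (OrderDual.toDual ∘ p) i} :=
    ⟨fun x y => Subtype.ext (hp (x.2.trans y.2.symm))⟩
  rw [Matrix.det_eq_elem_of_subsingleton _ ⟨i, rfl⟩]
  exact h i

theorem IsLower.inv (hp : p.Injective) {a : Matrix ι ι R} (ha : IsLower p a)
    (h : ∀ i, a i i ≠ 0) : IsLower p a⁻¹ := by
  have hb : Matrix.BlockTriangular a (OrderDual.toDual ∘ p) := fun i j hij => ha i j hij
  have := Matrix.invertibleOfIsUnitDet a (ha.isUnit_det hp h)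
  exact fun i j hij => Matrix.blockTriangular_inv_of_blockTriangular hb hij

theorem IsUnitLower.isUnit_det (hp : p.Injective) {a : Matrix ι ι R} (ha : IsUnitLower p a) :
    IsUnit a.det := ha.isLower.isUnit_det hp fun i => by simp [ha.2 i]

theorem IsUnitLower.inv (hp : p.Injective) {a : Matrix ι ι R} (ha : IsUnitLower p a) :
    IsUnitLower p a⁻¹ := by
  have hl : IsLower p a⁻¹ := ha.isLower.inv hp fun i => by simp [ha.2 i]
  have e : a⁻¹ - 1 = a⁻¹ * -(a - 1) := by
    rw [neg_sub, mul_sub, Matrix.nonsing_inv_mul _ (ha.isUnit_det hp), mul_one]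
  rw [isUnitLower_iff hp, e]
  refine hl.mul_isStrictLower fun i j hij => ?_
  rw [Matrix.neg_apply, (isUnitLower_iff hp).1 ha i j hij, neg_zero]

theorem IsUnitLower.mul (hp : p.Injective) {a b : Matrix ι ι R} (ha : IsUnitLower p a)
    (hb : IsUnitLower p b) : IsUnitLower p (a * b) := by
  rw [isUnitLower_iff hp] at ha ⊢
  have e : a * b - 1 = (a - 1) * b + (b - 1) := by noncomm_ring
  intro i j hij
  rw [e, Matrix.add_apply, ha.mul_isLower hb.isLower i j hij,
    (isUnitLower_iff hp).1 hb i j hij, add_zero]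

omit [Fintype ι] in
theorem isUnitLower_one : IsUnitLower p (1 : Matrix ι ι R) :=
  ⟨isLower_one, fun _ => Matrix.one_apply_eq _⟩

end Triangular

/-! ### Congruence of symmetric matrices: regularity, uniqueness of the canonical shape, pivots. -/

section Congruence

variable {F : Type*} [Field F] {n : ℕ}

/-- The stabilizer of `Q` for the infinitesimal congruence action of strictly lower triangular
matrices is trivial. -/
def IsRegular (Q : Matrix (Fin n) (Fin n) F) : Prop :=
  ∀ A : Matrix (Fin n) (Fin n) F, IsStrictLower Fin.val A → A * Q + (A * Q)ᵀ = 0 → A = 0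

/-- Symmetric matrices that are block diagonal with blocks `(x)` and `(0, x; x, 0)`, where
`x ≠ 0` except possibly for a last block of size one. -/
structure IsCanonical (Q : Matrix (Fin n) (Fin n) F) : Prop where
  symm : Q.IsSymm
  near : ∀ i j, Q i j ≠ 0 → (j : ℕ) ≤ i + 1
  unique : ∀ i j k, Q i j ≠ 0 → Q i k ≠ 0 → j = k
  nonzero : ∀ i : Fin n, (i : ℕ) + 1 < n → ∃ j, Q i j ≠ 0

theorem mul_apply_of_unique {Q : Matrix (Fin n) (Fin n) F}
    (hs : Q.IsSymm) (hu : ∀ i j k, Q i j ≠ 0 → Q i k ≠ 0 → j = k) (A : Matrix (Fin n) (Fin n) F)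
    {i j : Fin n} (h : Q i j ≠ 0) (k : Fin n) : (A * Q) k j = A k i * Q i j := by
  rw [Matrix.mul_apply, Finset.sum_eq_single i]
  · intro l _ hl
    by_contra hne
    have h1 : Q j l ≠ 0 := by
      rw [hs.apply]; exact right_ne_zero_of_mul hne
    have h2 : Q j i ≠ 0 := by rwa [hs.apply]
    exact hl (hu _ _ _ h1 h2)
  · simp

/-- To kill `A j i` with `i < j`, let `s` be the partner of `i`, the column of the nonzero entry of
row `i`. The `(j, s)` entry of `AQ + (AQ)ᵀ` is `A j i * Q i s` plus a term that vanishes by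
triangularity, or because column `j` of `Q` is zero, or else equals the first one, giving a factor
`2`. -/
theorem IsCanonical.isRegular (h2 : (2 : F) ≠ 0) {Q : Matrix (Fin n) (Fin n) F}
    (hQ : IsCanonical Q) : IsRegular Q := by
  intro A hA hAQ
  ext j i
  rcases le_or_gt j i with hji | hij
  · exact hA j i hji
  obtain ⟨s, hs⟩ := hQ.nonzero i (by omega)
  have hs' : (s : ℕ) ≤ i + 1 := hQ.near i s hs
  have hs'' : (i : ℕ) ≤ s + 1 := hQ.near s i (by rwa [hQ.symm.apply])
  have e := congrFun (congrFun hAQ j) s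
  rw [Matrix.add_apply, Matrix.transpose_apply, mul_apply_of_unique hQ.symm hQ.unique A hs,
    Matrix.zero_apply] at e
  by_cases hj : ∃ t, Q t j ≠ 0
  · obtain ⟨t, ht⟩ := hj
    rw [mul_apply_of_unique hQ.symm hQ.unique A ht] at e
    have ht' : (j : ℕ) ≤ t + 1 := hQ.near t j ht
    have ht'' : (t : ℕ) ≤ j + 1 := hQ.near j t (by rwa [hQ.symm.apply])
    rcases le_or_gt s t with hst | hst
    · rw [hA s t hst, zero_mul, add_zero] at e
      exact (mul_eq_zero.1 e).resolve_right hs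
    · have h1 : t = i := by ext; have : (t : ℕ) < s := hst; have : (i : ℕ) < j := hij; omega
      have h3 : s = j := by ext; have : (t : ℕ) < s := hst; have : (i : ℕ) < j := hij; omega
      subst h1 h3
      rw [← two_mul] at e
      exact (mul_eq_zero.1 ((mul_eq_zero.1 e).resolve_left h2)).resolve_right hs
  · push Not at hj
    have : (A * Q) s j = 0 := by
      rw [Matrix.mul_apply]; exact Finset.sum_eq_zero fun k _ => by rw [hj, mul_zero]
    rw [this, add_zero] at e
    exact (mul_eq_zero.1 e).resolve_right hs

/-- Compare the `(i, j)` entries of `aQ = Q'bᵀ` with `b = a⁻¹`. The left one is `Q i j`, so row `i`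
of `Q'` has a nonzero entry in some column `l ≤ j`. The induction on the column is applied with `Q`
and `Q'` interchanged. -/
theorem apply_eq_of_congruent (k : ℕ) : ∀ {Q Q' a b : Matrix (Fin n) (Fin n) F}, Q.IsSymm →
    (∀ i j k, Q i j ≠ 0 → Q i k ≠ 0 → j = k) → (∀ i j k, Q' i j ≠ 0 → Q' i k ≠ 0 → j = k) →
    Q'.IsSymm → IsUnitLower Fin.val a → IsUnitLower Fin.val b → a * b = 1 → b * a = 1 →
    Q' = a * Q * aᵀ → ∀ i j : Fin n, (j : ℕ) = k → Q i j ≠ 0 → Q i j = Q' i j := by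
  induction k using Nat.strong_induction_on with
  | _ k ih =>
    intro Q Q' a b hs hu hu' hs' ha hb hab hba hQ i j hj hij
    have hQ' : Q = b * Q' * bᵀ := by
      rw [hQ]
      calc Q = (b * a) * Q * (b * a)ᵀ := by simp [hba]
        _ = _ := by simp only [transpose_mul, mul_assoc]
    have e : a * Q = Q' * bᵀ := by
      rw [hQ, mul_assoc, ← transpose_mul, hba, transpose_one, mul_one]
    have e' := congrFun (congrFun e i) j
    rw [mul_apply_of_unique hs hu a hij, ha.2, one_mul] at e'
    obtain ⟨l, -, hl⟩ := Finset.exists_ne_zero_of_sum_ne_zero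
      (show ∑ l, Q' i l * bᵀ l j ≠ 0 by rw [← Matrix.mul_apply, ← e']; exact hij)
    have hl1 := left_ne_zero_of_mul hl
    have hlj : l ≤ j := by
      by_contra h
      exact right_ne_zero_of_mul hl (hb.1 j l (not_le.1 h))
    rcases hlj.lt_or_eq with hlt | rfl
    · have h3 := ih l (hj ▸ hlt) hs' hu' hu hs hb ha hba hab hQ' i l rfl hl1
      exact absurd (hu i l j (h3 ▸ hl1) hij) hlt.ne
    · rw [e', Matrix.mul_apply, Finset.sum_eq_single l]
      · rw [transpose_apply, hb.2, mul_one]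
      · intro m _ hm
        have : Q' i m = 0 := by
          by_contra h
          exact hm (hu' _ _ _ h hl1)
        rw [this, zero_mul]
      · simp

theorem IsCanonical.eq_of_congruent {Q a : Matrix (Fin n) (Fin n) F} (hQ : IsCanonical Q)
    (ha : IsUnitLower Fin.val a) (hQ' : IsCanonical (a * Q * aᵀ)) : a * Q * aᵀ = Q := by
  have hd := ha.isUnit_det Fin.val_injective
  have hb := ha.inv Fin.val_injective
  have hab := Matrix.mul_nonsing_inv a hd
  have hba := Matrix.nonsing_inv_mul a hd
  set Q' := a * Q * aᵀ with e
  have e' : Q = a⁻¹ * Q' * a⁻¹ᵀ := by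
    calc Q = (a⁻¹ * a) * Q * (a⁻¹ * a)ᵀ := by simp [hba]
      _ = _ := by rw [e]; simp only [transpose_mul, mul_assoc]
  ext i j
  by_cases h : Q i j = 0
  · by_contra h'
    have h3 : Q' i j ≠ 0 := by rwa [h] at h'
    exact h' (apply_eq_of_congruent j hQ'.symm hQ'.unique hQ.unique hQ.symm hb ha hba hab e'
      i j rfl h3)
  · exact (apply_eq_of_congruent j hQ.symm hQ.unique hQ'.unique hQ'.symm ha hb hab hba e
      i j rfl h).symm

theorem IsRegular.congr {Q a : Matrix (Fin n) (Fin n) F} (hQ : IsRegular Q)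
    (ha : IsUnitLower Fin.val a) : IsRegular (a * Q * aᵀ) := by
  have hd := ha.isUnit_det Fin.val_injective
  have hb := ha.inv Fin.val_injective
  have hab := Matrix.mul_nonsing_inv a hd
  have hba := Matrix.nonsing_inv_mul a hd
  intro A hA hAQ
  have h0 : a⁻¹ * A * a = 0 := by
    refine hQ _ ((hb.isLower.mul_isStrictLower hA).mul_isLower ha.isLower) ?_
    have e : a⁻¹ * (A * (a * Q * aᵀ)) * a⁻¹ᵀ = a⁻¹ * A * a * Q := by
      have : aᵀ * a⁻¹ᵀ = 1 := by rw [← transpose_mul, hba, transpose_one]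
      simp only [mul_assoc, this, mul_one]
    have := congrArg (fun M => a⁻¹ * M * a⁻¹ᵀ) hAQ
    simp only [mul_add, add_mul, e] at this
    rw [← e, transpose_mul, transpose_mul (a⁻¹), transpose_transpose, e]
    simpa [mul_assoc] using this
  calc A = (a * a⁻¹) * A * (a * a⁻¹) := by simp [hab]
    _ = a * (a⁻¹ * A * a) * a⁻¹ := by simp only [mul_assoc]
    _ = 0 := by simp [h0]

/-- The first `m` rows have the shape required by `IsCanonical`. -/
structure IsCanonicalUpTo (m : ℕ) (Q : Matrix (Fin n) (Fin n) F) : Prop where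
  symm : Q.IsSymm
  lt : ∀ i j : Fin n, (i : ℕ) < m → Q i j ≠ 0 → (j : ℕ) < m
  near : ∀ i j : Fin n, (i : ℕ) < m → Q i j ≠ 0 → (j : ℕ) ≤ i + 1
  unique : ∀ i j k : Fin n, (i : ℕ) < m → Q i j ≠ 0 → Q i k ≠ 0 → j = k
  nonzero : ∀ i : Fin n, (i : ℕ) < m → (i : ℕ) + 1 < n → ∃ j, Q i j ≠ 0

theorem isSymm_congr {Q : Matrix (Fin n) (Fin n) F} (hQ : Q.IsSymm)
    (a : Matrix (Fin n) (Fin n) F) : (a * Q * aᵀ).IsSymm := by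
  rw [Matrix.IsSymm, transpose_mul, transpose_mul, transpose_transpose, hQ.eq, mul_assoc]

theorem congr_apply (Q a : Matrix (Fin n) (Fin n) F) {i : Fin n} {r : Fin n → F}
    (hi : ∀ l, (a * Q) i l = r l) (j : Fin n) : (a * Q * aᵀ) i j = ∑ l, r l * a j l := by
  rw [Matrix.mul_apply]; simp [hi]

/-- If both entries vanish, the rank two matrix built from rows `x = m` and `y = m + 1` violates
regularity unless these rows are zero; and a zero row `x` violates it through an elementary matrix.
-/
theorem IsRegular.exists_pivot {Q : Matrix (Fin n) (Fin n) F} {m : ℕ}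
    (hQ : IsRegular Q) (hs : IsCanonicalUpTo m Q) (hm : m + 1 < n) :
    Q ⟨m, by omega⟩ ⟨m, by omega⟩ ≠ 0 ∨ Q ⟨m, by omega⟩ ⟨m + 1, hm⟩ ≠ 0 := by
  by_contra! h
  obtain ⟨h1, h3⟩ := h
  set x : Fin n := ⟨m, by omega⟩ with hx
  set y : Fin n := ⟨m + 1, hm⟩ with hy
  have hxy : x ≠ y := by simp [hx, hy]
  have h3' : Q y x = 0 := by rwa [hs.symm.apply]
  have hz : ∀ i j : Fin n, (i : ℕ) < m → m ≤ (j : ℕ) → Q j i = 0 := by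
    intro i j hi hj
    by_contra h
    exact absurd (hs.lt i j hi (by rwa [hs.symm.apply])) (by omega)
  have h0 : ∀ i, Q x i = 0 ∧ Q y i = 0 := by
    -- For this `A` one has `(AQ) i j = Q x i * Q y j - Q y i * Q x j`, which is skew-symmetric. It
    -- is strictly lower triangular because `Q x x = Q x y = 0` and the finished rows do not meet
    -- rows `x` and `y`.
    have := hQ (vecMulVec (Q x) (Pi.single y 1) - vecMulVec (Q y) (Pi.single x 1)) ?_ ?_
    · intro i
      have e1 := congrFun (congrFun this i) x
      have e2 := congrFun (congrFun this i) y
      simp [vecMulVec_apply, hxy, hxy.symm] at e1 e2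
      exact ⟨e2, e1⟩
    · intro i j hij
      simp only [Matrix.sub_apply, vecMulVec_apply, Pi.single_apply]
      rcases lt_or_ge (i : ℕ) m with hi | hi
      · rw [hz i x hi le_rfl, hz i y hi (by simp [hy])]; simp
      · by_cases hjx : j = x
        · subst hjx
          have : i = x := by ext; simp [hx] at hij ⊢; omega
          subst this
          simp [hxy, h3']
        · by_cases hjy : j = y
          · subst hjy
            have : i = x ∨ i = y := by
              simp [hx, hy, Fin.ext_iff] at hij ⊢; omega
            rcases this with rfl | rfl <;> simp [h1, h3, hxy.symm]
          · simp [hjx, hjy]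
    · ext i j
      simp [Matrix.sub_mul, vecMulVec_mul, vecMulVec_apply]
  have h4 := hQ (Matrix.single y x 1) ?_ ?_
  · have := congrFun (congrFun h4 y) x
    simp at this
  · intro i j hij
    rw [Matrix.single_apply, if_neg]
    rintro ⟨rfl, rfl⟩
    simp [hx, hy] at hij
  · have : Matrix.single y x (1 : F) * Q = 0 := by
      ext i j
      rw [Matrix.mul_apply]
      refine Finset.sum_eq_zero fun k _ => ?_
      rw [Matrix.single_apply]
      split_ifs with h
      · rw [← h.2, (h0 j).1, mul_zero]
      · rw [zero_mul]
    rw [this]; simp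

/-- The finished rows are supported in the first `m` columns, where `a` agrees with the identity, so
later eliminations leave them alone. -/
theorem congr_apply_of_lt {Q a : Matrix (Fin n) (Fin n) F} {m : ℕ}
    (hs : IsCanonicalUpTo m Q) (ha : IsUnitLower Fin.val a)
    (ha' : ∀ i j : Fin n, (j : ℕ) < m → a i j = (1 : Matrix (Fin n) (Fin n) F) i j)
    {i : Fin n} (hi : (i : ℕ) < m) (j : Fin n) : (a * Q * aᵀ) i j = Q i j := by
  rw [congr_apply Q a (r := Q i)]
  · rw [Finset.sum_eq_single j]
    · rw [ha.2, mul_one]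
    · intro l _ hl
      by_cases h : Q i l = 0
      · rw [h, zero_mul]
      · rw [ha' j l (hs.lt i l hi h), Matrix.one_apply_ne hl.symm, mul_zero]
    · simp
  · intro l
    rw [Matrix.mul_apply, Finset.sum_eq_single i]
    · rw [ha.2, one_mul]
    · intro k _ hk
      rcases lt_or_ge (k : ℕ) m with h | h
      · rw [ha' i k h, Matrix.one_apply_ne hk.symm, zero_mul]
      · rw [ha.1 i k (by omega), zero_mul]
    · simp

end Congruence

/-! ### Symmetric elimination to the canonical shape. -/

section Elimination

variable {F : Type*} [Field F] {n : ℕ}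

/-- By symmetry the last row can only have a diagonal entry, and no condition is imposed on its
value. -/
theorem IsCanonicalUpTo.succ_of_last {Q : Matrix (Fin n) (Fin n) F} {m : ℕ}
    (hs : IsCanonicalUpTo m Q) (hm : m + 1 = n) : IsCanonicalUpTo (m + 1) Q := by
  have key : ∀ i j : Fin n, ¬ (i : ℕ) < m → Q i j ≠ 0 → (j : ℕ) = m := by
    intro i j hi hij
    by_contra h
    exact hi (hs.lt j i (by omega) (by rwa [hs.symm.apply]))
  refine ⟨hs.symm, fun i j _ _ => by omega, ?_, ?_, ?_⟩
  · intro i j _ hij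
    by_cases h : (i : ℕ) < m
    · exact hs.near i j h hij
    · have := key i j h hij
      omega
  · intro i j k _ hij hik
    by_cases h : (i : ℕ) < m
    · exact hs.unique i j k h hij hik
    · ext; rw [key i j h hij, key i k h hik]
  · intro i _ hi
    exact hs.nonzero i (by omega) hi

theorem IsCanonicalUpTo.exists_succ {Q : Matrix (Fin n) (Fin n) F} {m : ℕ}
    (hs : IsCanonicalUpTo m Q) (hm : m < n) (h : Q ⟨m, hm⟩ ⟨m, hm⟩ ≠ 0) :
    ∃ a, IsUnitLower Fin.val a ∧ IsCanonicalUpTo (m + 1) (a * Q * aᵀ) := by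
  set x : Fin n := ⟨m, hm⟩ with hx
  -- Subtracting `v i` times row `x` from row `i`, for `i > m`, clears row and column `x` off the
  -- diagonal.
  let v : Fin n → F := fun i => if m < (i : ℕ) then Q x i / Q x x else 0
  let a : Matrix (Fin n) (Fin n) F := 1 - vecMulVec v (Pi.single x 1)
  have hax : ∀ j l, a j l = (1 : Matrix (Fin n) (Fin n) F) j l - if l = x then v j else 0 := by
    intro j l
    simp [a, vecMulVec_apply, Pi.single_apply]
  have hv : ∀ i : Fin n, (i : ℕ) ≤ m → v i = 0 := fun i hi => if_neg (by omega)
  have ha : IsUnitLower Fin.val a := by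
    rw [isUnitLower_iff Fin.val_injective]
    intro i j hij
    rw [Matrix.sub_apply, hax]
    split_ifs with hj
    · subst hj; rw [hv i hij]; ring
    · ring
  have ha' : ∀ i j : Fin n, (j : ℕ) < m → a i j = (1 : Matrix (Fin n) (Fin n) F) i j := by
    intro i j hj
    rw [hax, if_neg (by rintro rfl; simp [hx] at hj), sub_zero]
  refine ⟨a, ha, ?_⟩
  have hsymm := isSymm_congr hs.symm a
  have hlow := fun i hi => congr_apply_of_lt hs ha ha' (i := i) hi
  have hrow : ∀ j, (a * Q * aᵀ) x j = Q x j - v j * Q x x := by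
    intro j
    rw [congr_apply Q a (r := Q x)]
    · simp only [hax, Matrix.one_apply, mul_sub, Finset.sum_sub_distrib, mul_ite, mul_one,
        mul_zero, Finset.sum_ite_eq, Finset.sum_ite_eq', Finset.mem_univ, if_true]
      ring
    · intro l
      rw [Matrix.mul_apply]
      simp only [hax, hv x le_rfl]
      simp [Matrix.one_apply]
  set Q' := a * Q * aᵀ
  have hrow' : ∀ j, Q' x j ≠ 0 → j = x := by
    intro j hj
    rcases lt_trichotomy (j : ℕ) m with hlt | he | hgt
    · rw [hrow, hv j hlt.le, zero_mul, sub_zero] at hj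
      exact absurd (hs.lt j x hlt (by rwa [hs.symm.apply])) (lt_irrefl m)
    · ext; exact he
    · rw [hrow] at hj
      simp only [v, hgt, if_true] at hj
      rw [div_mul_cancel₀ _ h] at hj
      simp at hj
  have hcase : ∀ i : Fin n, (i : ℕ) < m + 1 → (i : ℕ) < m ∨ i = x := by
    intro i hi
    rcases Nat.lt_succ_iff_lt_or_eq.1 hi with h | h
    · exact Or.inl h
    · exact Or.inr (Fin.ext h)
  refine ⟨hsymm, ?_, ?_, ?_, ?_⟩
  · intro i j hi hij
    rcases hcase i hi with hi | rfl
    · rw [hlow i hi] at hij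
      have := hs.lt i j hi hij
      omega
    · rw [hrow' j hij]; simp [hx]
  · intro i j hi hij
    rcases hcase i hi with hi | rfl
    · rw [hlow i hi] at hij
      exact hs.near i j hi hij
    · rw [hrow' j hij]; simp [hx]
  · intro i j k hi hij hik
    rcases hcase i hi with hi | rfl
    · rw [hlow i hi] at hij hik
      exact hs.unique i j k hi hij hik
    · rw [hrow' j hij, hrow' k hik]
  · intro i hi hin
    rcases hcase i hi with hi | rfl
    · obtain ⟨j, hj⟩ := hs.nonzero i hi hin
      exact ⟨j, by rwa [hlow i hi]⟩
    · exact ⟨x, by rw [hrow, hv x le_rfl]; simpa using h⟩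

theorem IsCanonicalUpTo.exists_add_two (h2 : (2 : F) ≠ 0) {Q : Matrix (Fin n) (Fin n) F} {m : ℕ}
    (hs : IsCanonicalUpTo m Q) (hm : m + 1 < n)
    (h0 : Q ⟨m, by omega⟩ ⟨m, by omega⟩ = 0) (h : Q ⟨m, by omega⟩ ⟨m + 1, hm⟩ ≠ 0) :
    ∃ a, IsUnitLower Fin.val a ∧ IsCanonicalUpTo (m + 2) (a * Q * aᵀ) := by
  set x : Fin n := ⟨m, by omega⟩ with hx
  set y : Fin n := ⟨m + 1, hm⟩ with hy
  have hxy : x ≠ y := by simp [hx, hy]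
  have hyx : Q y x = Q x y := hs.symm.apply _ _
  -- Replacing row `y` by `r`, row `y` minus `s` times row `x`, and likewise for columns, makes the
  -- `(y, y)` entry zero; the cross term counts twice, whence the `2`.
  let s : F := Q y y / (2 * Q x y)
  let r : Fin n → F := fun l => Q y l - s * Q x l
  have hrx : r x = Q x y := by simp [r, h0, hyx]
  have hry : r y = s * Q x y := by simp only [r, s]; field_simp; ring
  -- The multiples `w` of row `y` clear row `x` beyond `y`; the multiples `v` of row `x` then clear
  -- row `y` beyond `x`. The formula for `v` uses `r`, hence `s`, and is consistent since it gives
  -- `v y = s`.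
  let w : Fin n → F := fun i => if m + 1 < (i : ℕ) then Q x i / Q x y else 0
  let v : Fin n → F := fun i => if m < (i : ℕ) then (r i - w i * r y) / Q x y else 0
  have hw : ∀ i : Fin n, (i : ℕ) ≤ m + 1 → w i = 0 := fun i hi => if_neg (by omega)
  have hv : ∀ i : Fin n, (i : ℕ) ≤ m → v i = 0 := fun i hi => if_neg (by omega)
  have hvy : v y = s := by
    simp only [v, hw y le_rfl]
    rw [if_pos (by simp [hy]), hry]
    field_simp
    ring
  let a : Matrix (Fin n) (Fin n) F :=
    1 - vecMulVec v (Pi.single x 1) - vecMulVec w (Pi.single y 1)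
  have hax : ∀ j l, a j l = (1 : Matrix (Fin n) (Fin n) F) j l - (if l = x then v j else 0)
      - if l = y then w j else 0 := by
    intro j l
    simp [a, vecMulVec_apply, Pi.single_apply]
  have ha : IsUnitLower Fin.val a := by
    rw [isUnitLower_iff Fin.val_injective]
    intro i j hij
    rw [Matrix.sub_apply, hax]
    split_ifs with hj hj' hj'
    · exact absurd (hj.symm.trans hj') hxy
    · subst hj; rw [hv i hij]; ring
    · subst hj'; rw [hw i hij]; ring
    · ring
  have ha' : ∀ i j : Fin n, (j : ℕ) < m → a i j = (1 : Matrix (Fin n) (Fin n) F) i j := by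
    intro i j hj
    rw [hax, if_neg (by rintro rfl; simp [hx] at hj), if_neg (by rintro rfl; simp [hy] at hj),
      sub_zero, sub_zero]
  refine ⟨a, ha, ?_⟩
  have hsymm := isSymm_congr hs.symm a
  have hlow := fun i hi => congr_apply_of_lt hs ha ha' (i := i) hi
  have hsum : ∀ (ρ : Fin n → F) (j : Fin n), ∑ l, ρ l * a j l = ρ j - v j * ρ x - w j * ρ y := by
    intro ρ j
    simp only [hax, Matrix.one_apply, mul_sub, Finset.sum_sub_distrib, mul_ite, mul_one,
      mul_zero, Finset.sum_ite_eq, Finset.sum_ite_eq', Finset.mem_univ, if_true]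
    ring
  have hrowx : ∀ j, (a * Q * aᵀ) x j = Q x j - w j * Q x y := by
    intro j
    rw [congr_apply Q a (r := Q x), hsum, h0]
    · ring
    · intro l
      rw [Matrix.mul_apply]
      simp only [hax, hv x le_rfl, hw x (Nat.le_succ m)]
      simp [Matrix.one_apply]
  have hrowy : ∀ j, (a * Q * aᵀ) y j = r j - v j * Q x y - w j * r y := by
    intro j
    rw [congr_apply Q a (r := r), hsum, hrx]
    intro l
    rw [Matrix.mul_apply]
    simp only [hax, hvy, hw y le_rfl]
    simp [Matrix.one_apply, sub_mul, r]
  set Q' := a * Q * aᵀ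
  have hz : ∀ j : Fin n, (j : ℕ) < m → Q x j = 0 ∧ Q y j = 0 := by
    intro j hj
    constructor <;> by_contra hne <;> rw [hs.symm.apply] at hne
    · exact absurd (hs.lt j x hj hne) (lt_irrefl m)
    · exact absurd (hs.lt j y hj hne) (by simp [hy])
  have hrowx' : ∀ j, Q' x j ≠ 0 → j = y := by
    intro j hj
    rw [hrowx] at hj
    by_contra hjy
    rcases lt_or_ge (m + 1) (j : ℕ) with hgt | hle
    · simp only [w, hgt, if_true] at hj
      rw [div_mul_cancel₀ _ h] at hj
      simp at hj
    · rw [hw j hle, zero_mul, sub_zero] at hj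
      have hjy' : (j : ℕ) ≠ m + 1 := fun e => hjy (Fin.ext e)
      rcases Nat.lt_or_ge j m with hlt | hge
      · exact hj (hz j hlt).1
      · have : j = x := Fin.ext (show (j : ℕ) = m by omega)
        exact hj (this ▸ h0)
  have hrowy' : ∀ j, Q' y j ≠ 0 → j = x := by
    intro j hj
    by_contra hjx
    rw [hrowy] at hj
    rcases lt_or_ge m (j : ℕ) with hgt | hle
    · simp only [v, hgt, if_true] at hj
      rw [div_mul_cancel₀ _ h] at hj
      simp at hj
    · have hlt : (j : ℕ) < m := lt_of_le_of_ne hle fun e => hjx (Fin.ext e)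
      rw [hv j hle, hw j (by omega)] at hj
      simp [r, hz j hlt] at hj
  have hcase : ∀ i : Fin n, (i : ℕ) < m + 2 → (i : ℕ) < m ∨ i = x ∨ i = y := by
    intro i hi
    simp only [Fin.ext_iff, hx, hy]
    omega
  have hQxy : Q' x y ≠ 0 := by rw [hrowx, hw y le_rfl]; simpa using h
  refine ⟨hsymm, ?_, ?_, ?_, ?_⟩
  · intro i j hi hij
    rcases hcase i hi with hi | rfl | rfl
    · rw [hlow i hi] at hij
      have := hs.lt i j hi hij
      omega
    · rw [hrowx' j hij]; simp [hy]
    · rw [hrowy' j hij]; simp [hx]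
  · intro i j hi hij
    rcases hcase i hi with hi | rfl | rfl
    · rw [hlow i hi] at hij
      exact hs.near i j hi hij
    · rw [hrowx' j hij]
    · rw [hrowy' j hij]; simp only [hx, hy]; omega
  · intro i j k hi hij hik
    rcases hcase i hi with hi | rfl | rfl
    · rw [hlow i hi] at hij hik
      exact hs.unique i j k hi hij hik
    · rw [hrowx' j hij, hrowx' k hik]
    · rw [hrowy' j hij, hrowy' k hik]
  · intro i hi hin
    rcases hcase i hi with hi | rfl | rfl
    · obtain ⟨j, hj⟩ := hs.nonzero i hi hin
      exact ⟨j, by rwa [hlow i hi]⟩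
    · exact ⟨y, hQxy⟩
    · exact ⟨x, by rwa [hsymm.apply]⟩

/-- Induction on the number `k` of unfinished rows. Congruence preserves regularity, so a pivot
exists as long as `k ≥ 2`. -/
theorem IsRegular.exists_isCanonicalUpTo (h2 : (2 : F) ≠ 0) (k : ℕ) :
    ∀ (m : ℕ) {Q : Matrix (Fin n) (Fin n) F}, IsRegular Q → IsCanonicalUpTo m Q → m + k = n →
      ∃ a, IsUnitLower Fin.val a ∧ IsCanonicalUpTo n (a * Q * aᵀ) := by
  induction k using Nat.strong_induction_on with
  | _ k ih =>
    intro m Q hQ hs hm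
    have step : ∀ (l : ℕ) (a : Matrix (Fin n) (Fin n) F), 0 < l → l ≤ k → IsUnitLower Fin.val a →
        IsCanonicalUpTo (m + l) (a * Q * aᵀ) →
        ∃ a, IsUnitLower Fin.val a ∧ IsCanonicalUpTo n (a * Q * aᵀ) := by
      intro l a hl hlk ha hc
      obtain ⟨b, hb, hbc⟩ := ih (k - l) (by omega) (m + l) (hQ.congr ha) hc (by omega)
      exact ⟨b * a, hb.mul Fin.val_injective ha, by simpa [mul_assoc] using hbc⟩
    rcases Nat.lt_trichotomy k 1 with h | h | h
    · obtain rfl : m = n := by omega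
      exact ⟨1, isUnitLower_one, by simpa using hs⟩
    · exact step 1 1 one_pos (by omega) isUnitLower_one
        (by simpa using hs.succ_of_last (by omega))
    · by_cases h0 : Q ⟨m, by omega⟩ ⟨m, by omega⟩ = 0
      · obtain ⟨a, ha, hc⟩ := hs.exists_add_two h2 (by omega) h0
          ((hQ.exists_pivot hs (by omega)).resolve_left (not_not.2 h0))
        exact step 2 a two_pos (by omega) ha hc
      · obtain ⟨a, ha, hc⟩ := hs.exists_succ (by omega) h0
        exact step 1 a one_pos (by omega) ha hc

theorem IsRegular.exists_isCanonical (h2 : (2 : F) ≠ 0) {Q : Matrix (Fin n) (Fin n) F}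
    (hQ : IsRegular Q) (hs : Q.IsSymm) :
    ∃ a, IsUnitLower Fin.val a ∧ IsCanonical (a * Q * aᵀ) := by
  obtain ⟨a, ha, hc⟩ := hQ.exists_isCanonicalUpTo h2 n 0
    ⟨hs, fun _ _ h => absurd h (Nat.not_lt_zero _), fun _ _ h => absurd h (Nat.not_lt_zero _),
      fun _ _ _ h => absurd h (Nat.not_lt_zero _), fun _ h => absurd h (Nat.not_lt_zero _)⟩
    (zero_add n)
  exact ⟨a, ha, hc.symm, fun i j => hc.near i j i.2, fun i j k => hc.unique i j k i.2,
    fun i => hc.nonzero i i.2⟩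

end Elimination

/-! ### Rank of a bilinear form with a totally isotropic subspace. -/

section SkewForm

variable {K V : Type*} [Field K] [AddCommGroup V] [Module K V] [FiniteDimensional K V]

theorem finrank_map_add_finrank_inf_ker {V' : Type*} [AddCommGroup V'] [Module K V']
    (β : V →ₗ[K] V') (W : Submodule K V) :
    Module.finrank K (W.map β) + Module.finrank K (W ⊓ LinearMap.ker β : Submodule K V) =
      Module.finrank K W := by
  rw [← LinearMap.finrank_range_add_finrank_ker (β.domRestrict W), LinearMap.range_domRestrict,
    LinearMap.ker_domRestrict, ← Submodule.finrank_map_subtype_eq, Submodule.map_comap_subtype]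

/-- The orthogonal complement of `W` for a bilinear form. -/
def orthComp (β : V →ₗ[K] Module.Dual K V) (W : Submodule K V) : Submodule K V :=
  (W.map β).dualCoannihilator

omit [FiniteDimensional K V] in
theorem mem_orthComp {β : V →ₗ[K] Module.Dual K V} {W : Submodule K V} {x : V} :
    x ∈ orthComp β W ↔ ∀ w ∈ W, β w x = 0 := by
  simp [orthComp, Submodule.mem_dualCoannihilator]

variable {β : V →ₗ[K] Module.Dual K V} {W : Submodule K V}

/-- The complement has dimension `dim V - dim β(W)`, and `β(W)` loses at most `dim ker β` from `dim
W`. -/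
theorem finrank_range_add_finrank_orthComp_add_le :
    Module.finrank K (LinearMap.range β) + Module.finrank K W + Module.finrank K (orthComp β W) ≤
      2 * Module.finrank K V := by
  have h1 := LinearMap.finrank_range_add_finrank_ker β
  have h2 := finrank_map_add_finrank_inf_ker β W
  have h3 := Subspace.finrank_add_finrank_dualCoannihilator_eq (W.map β)
  have h4 := Submodule.finrank_mono (R := K) (inf_le_right : W ⊓ LinearMap.ker β ≤ _)
  change _ + Module.finrank K (orthComp β W) = _ at h3
  omega

omit [FiniteDimensional K V] in
theorem le_orthComp (hW : ∀ x ∈ W, ∀ y ∈ W, β x y = 0) : W ≤ orthComp β W :=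
  fun x hx => mem_orthComp.2 fun w hw => hW w hw x hx

theorem finrank_range_add_le (hW : ∀ x ∈ W, ∀ y ∈ W, β x y = 0) :
    Module.finrank K (LinearMap.range β) + 2 * Module.finrank K W ≤ 2 * Module.finrank K V := by
  have h1 := finrank_range_add_finrank_orthComp_add_le (β := β) (W := W)
  have h2 := Submodule.finrank_mono (R := K) (le_orthComp hW)
  omega

/-- Equality leaves no room between `W` and its complement. Conversely, skewness puts `ker β` inside
the complement, hence inside `W`, and the dimension count becomes exact. -/
theorem finrank_range_add_eq_iff (hβ : ∀ x y, β x y = -β y x)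
    (hW : ∀ x ∈ W, ∀ y ∈ W, β x y = 0) :
    Module.finrank K (LinearMap.range β) + 2 * Module.finrank K W = 2 * Module.finrank K V ↔
      orthComp β W ≤ W := by
  constructor
  · intro h
    have h1 := finrank_range_add_finrank_orthComp_add_le (β := β) (W := W)
    exact (Submodule.eq_of_le_of_finrank_le (le_orthComp hW) (by omega)).ge
  · intro h
    have h1 := LinearMap.finrank_range_add_finrank_ker β
    have h2 := finrank_map_add_finrank_inf_ker β W
    have h3 := Subspace.finrank_add_finrank_dualCoannihilator_eq (W.map β)
    have hker : LinearMap.ker β ≤ W := fun x hx => h (mem_orthComp.2 fun w _ => by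
      rw [hβ, LinearMap.mem_ker.1 hx]; simp)
    rw [inf_eq_right.2 hker] at h2
    change _ + Module.finrank K (orthComp β W) = _ at h3
    rw [le_antisymm h (le_orthComp hW)] at h3
    omega

theorem map_eq_dualAnnihilator (hW : ∀ x ∈ W, ∀ y ∈ W, β x y = 0) (h : orthComp β W ≤ W) :
    W.map β = W.dualAnnihilator := by
  have e : W = (W.map β).dualCoannihilator := le_antisymm (le_orthComp hW) h
  conv_rhs => rw [e]
  exact Subspace.dualCoannihilator_dualAnnihilator_eq.symm

end SkewForm

/-! ### The Cayley transform and the dimension of a coadjoint orbit. -/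

section Cayley

variable {F : Type*} [Field F] {n : ℕ}

theorem isStrictLower_of_mem_nilp {X : Matrix (Fin n ⊕ Fin n) (Fin n ⊕ Fin n) F}
    (hX : X ∈ nilp F n) : IsStrictLower pos X := (mem_nilp_iff.1 hX).2

theorem transpose_mul_J_of_mem_nilp {X : Matrix (Fin n ⊕ Fin n) (Fin n ⊕ Fin n) F}
    (hX : X ∈ nilp F n) : Xᵀ * J (Fin n) F = -(J (Fin n) F * X) :=
  mem_sp_iff.1 (mem_nilp_iff.1 hX).1

theorem isUnitLower_one_add {X : Matrix (Fin n ⊕ Fin n) (Fin n ⊕ Fin n) F}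
    (hX : X ∈ nilp F n) : IsUnitLower pos (1 + X) := by
  rw [isUnitLower_iff pos_injective, add_sub_cancel_left]
  exact isStrictLower_of_mem_nilp hX

theorem isUnitLower_one_sub {X : Matrix (Fin n ⊕ Fin n) (Fin n ⊕ Fin n) F}
    (hX : X ∈ nilp F n) : IsUnitLower pos (1 - X) := by
  rw [sub_eq_add_neg]
  exact isUnitLower_one_add (neg_mem hX)

theorem cayley_mem_symplecticGroup {X : Matrix (Fin n ⊕ Fin n) (Fin n ⊕ Fin n) F}
    (hX : X ∈ nilp F n) : (1 - X)⁻¹ * (1 + X) ∈ symplecticGroup (Fin n) F := by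
  have hd := (isUnitLower_one_sub hX).isUnit_det pos_injective
  set y := (1 - X)⁻¹ with hy
  have h1 : (1 - X) * y = 1 := Matrix.mul_nonsing_inv _ hd
  have h2 : y * (1 - X) = 1 := Matrix.nonsing_inv_mul _ hd
  have hc : y * (1 + X) = (1 + X) * y := by
    have e : 1 + X = 2 - (1 - X) := by rw [← one_add_one_eq_two]; abel
    rw [e, mul_sub, sub_mul, h1, h2, mul_two, two_mul]
  rw [SymplecticGroup.mem_iff']
  have hJ : (1 + X)ᵀ * J (Fin n) F * (1 + X) = (1 - X)ᵀ * J (Fin n) F * (1 - X) := by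
    have := transpose_mul_J_of_mem_nilp hX
    simp only [transpose_add, transpose_sub, transpose_one, add_mul, sub_mul, one_mul, mul_add,
      mul_sub, mul_one, this]
    abel
  calc (y * (1 + X))ᵀ * J (Fin n) F * (y * (1 + X))
      = yᵀ * ((1 + X)ᵀ * J (Fin n) F * (1 + X)) * y := by
        rw [hc, transpose_mul]; simp only [mul_assoc]
    _ = ((1 - X) * y)ᵀ * J (Fin n) F * ((1 - X) * y) := by
        rw [hJ, transpose_mul]; simp only [mul_assoc]
    _ = J (Fin n) F := by rw [h1]; simp

theorem isUnit_det_add_one (h2 : (2 : F) ≠ 0) (g : unip F n) : IsUnit (g.1.1 + 1).det := by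
  have hg : IsUnitLower pos g.1.1 := g.2
  refine (hg.isLower.add isLower_one).isUnit_det pos_injective fun i => ?_
  rw [Matrix.add_apply, hg.2, Matrix.one_apply_eq, one_add_one_eq_two]
  exact h2

theorem cayley_symm_mem_nilp (h2 : (2 : F) ≠ 0) (g : unip F n) :
    (g.1.1 - 1) * (g.1.1 + 1)⁻¹ ∈ nilp F n := by
  have hg : IsUnitLower pos g.1.1 := g.2
  have hd := isUnit_det_add_one h2 g
  have hlow : IsLower pos (g.1.1 + 1)⁻¹ := by
    refine (hg.isLower.add isLower_one).inv pos_injective fun i => ?_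
    rw [Matrix.add_apply, hg.2, Matrix.one_apply_eq, one_add_one_eq_two]
    exact h2
  refine mem_nilp_iff.2 ⟨?_, ((isUnitLower_iff pos_injective).1 hg).mul_isLower hlow⟩
  have hJ := SymplecticGroup.mem_iff'.1 g.1.2
  set a := g.1.1
  set w := (a + 1)⁻¹ with hw
  have h1 : (a + 1) * w = 1 := Matrix.mul_nonsing_inv _ hd
  have h1' : wᵀ * (a + 1)ᵀ = 1 := by rw [← transpose_mul, h1, transpose_one]
  rw [mem_sp_iff, eq_neg_iff_add_eq_zero]
  have key : (a - 1)ᵀ * J (Fin n) F * (a + 1) + (a + 1)ᵀ * J (Fin n) F * (a - 1) = 0 := by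
    simp only [transpose_add, transpose_sub, transpose_one, add_mul, sub_mul, one_mul, mul_add,
      mul_sub, mul_one, hJ]
    abel
  calc ((a - 1) * w)ᵀ * J (Fin n) F + J (Fin n) F * ((a - 1) * w)
      = wᵀ * (a - 1)ᵀ * J (Fin n) F * ((a + 1) * w) +
          (wᵀ * (a + 1)ᵀ) * J (Fin n) F * ((a - 1) * w) := by
        rw [h1, h1', transpose_mul, mul_one, one_mul]
    _ = wᵀ * ((a - 1)ᵀ * J (Fin n) F * (a + 1) + (a + 1)ᵀ * J (Fin n) F * (a - 1)) * w := by
        simp only [mul_add, add_mul, mul_assoc]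
    _ = 0 := by rw [key]; simp

/-- The Cayley transform `x ↦ (1 - x)⁻¹ (1 + x)` from `𝔲` to `U`. -/
noncomputable def cayley (h2 : (2 : F) ≠ 0) : nilp F n ≃ unip F n where
  toFun x := ⟨⟨(1 - x.1)⁻¹ * (1 + x.1), cayley_mem_symplecticGroup x.2⟩,
    ((isUnitLower_one_sub x.2).inv pos_injective).mul pos_injective (isUnitLower_one_add x.2)⟩
  invFun g := ⟨(g.1.1 - 1) * (g.1.1 + 1)⁻¹, cayley_symm_mem_nilp h2 g⟩
  left_inv x := by
    have hd := (isUnitLower_one_sub x.2).isUnit_det pos_injective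
    set g : unip F n := ⟨⟨(1 - x.1)⁻¹ * (1 + x.1), cayley_mem_symplecticGroup x.2⟩,
      ((isUnitLower_one_sub x.2).inv pos_injective).mul pos_injective
        (isUnitLower_one_add x.2)⟩ with hg
    have h1 : (1 - x.1) * g.1.1 = 1 + x.1 := Matrix.mul_nonsing_inv_cancel_left _ _ hd
    have h3 : g.1.1 - 1 = x.1 * (g.1.1 + 1) := by
      rw [sub_mul, one_mul] at h1
      rw [mul_add, mul_one, ← sub_eq_zero]
      rw [← sub_eq_zero] at h1
      rw [← h1]; abel
    refine Subtype.ext ?_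
    change (g.1.1 - 1) * (g.1.1 + 1)⁻¹ = x.1
    rw [h3, Matrix.mul_nonsing_inv_cancel_right _ _ (isUnit_det_add_one h2 g)]
  right_inv g := by
    have hx := cayley_symm_mem_nilp h2 g
    refine Subtype.ext (Subtype.ext ?_)
    change (1 - (g.1.1 - 1) * (g.1.1 + 1)⁻¹)⁻¹ * (1 + (g.1.1 - 1) * (g.1.1 + 1)⁻¹) = g.1.1
    have h3 := Matrix.nonsing_inv_mul_cancel_right (A := g.1.1 + 1) (g.1.1 - 1)
      (isUnit_det_add_one h2 g)
    set X := (g.1.1 - 1) * (g.1.1 + 1)⁻¹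
    have h4 : 1 + X = (1 - X) * g.1.1 := by
      rw [mul_add, mul_one] at h3
      rw [sub_mul, one_mul, ← sub_eq_zero]
      rw [← sub_eq_zero] at h3
      rw [← h3]; abel
    rw [h4, Matrix.nonsing_inv_mul_cancel_left _ _
      ((isUnitLower_one_sub hx).isUnit_det pos_injective)]

theorem one_sub_mul_cayley (h2 : (2 : F) ≠ 0) (x : nilp F n) :
    (1 - x.1) * (cayley h2 x).1.1 = 1 + x.1 :=
  Matrix.mul_nonsing_inv_cancel_left _ _ ((isUnitLower_one_sub x.2).isUnit_det pos_injective)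

theorem cayley_mul_one_sub (h2 : (2 : F) ≠ 0) (x : nilp F n) :
    (cayley h2 x).1.1 * (1 - x.1) = 1 + x.1 := by
  have hd := (isUnitLower_one_sub x.2).isUnit_det pos_injective
  change (1 - x.1)⁻¹ * (1 + x.1) * (1 - x.1) = 1 + x.1
  have e : (1 + x.1) * (1 - x.1) = (1 - x.1) * (1 + x.1) := by noncomm_ring
  rw [mul_assoc, e, Matrix.nonsing_inv_mul_cancel_left _ _ hd]

theorem commutator_mem_nilp {X Y : Matrix (Fin n ⊕ Fin n) (Fin n ⊕ Fin n) F}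
    (hX : X ∈ nilp F n) (hY : Y ∈ nilp F n) : X * Y - Y * X ∈ nilp F n := by
  have h1 := isStrictLower_of_mem_nilp hX
  have h2 := isStrictLower_of_mem_nilp hY
  have h3 := transpose_mul_J_of_mem_nilp hX
  have h4 := transpose_mul_J_of_mem_nilp hY
  refine mem_nilp_iff.2 ⟨mem_sp_iff.2 ?_, fun i j hij => ?_⟩
  · rw [transpose_sub, transpose_mul, transpose_mul, sub_mul, mul_assoc, mul_assoc, h3, h4,
      mul_neg, mul_neg, ← mul_assoc, ← mul_assoc, h3, h4, mul_sub]
    noncomm_ring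
  rw [Matrix.sub_apply, h1.mul_isLower h2.isLower i j hij, h2.mul_isLower h1.isLower i j hij,
    sub_zero]

variable (F n) in
/-- The Lie bracket of `𝔲`. -/
def nilpBracket : nilp F n →ₗ[F] nilp F n →ₗ[F] nilp F n :=
  LinearMap.mk₂ F (fun X Y => ⟨X.1 * Y.1 - Y.1 * X.1, commutator_mem_nilp X.2 Y.2⟩)
    (fun X Y Z => Subtype.ext (by simp [add_mul, mul_add]; abel))
    (fun c X Y => Subtype.ext (by simp [smul_sub]))
    (fun X Y Z => Subtype.ext (by simp [add_mul, mul_add]; abel))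
    (fun c X Y => Subtype.ext (by simp [smul_sub]))

@[simp] theorem coe_nilpBracket (X Y : nilp F n) :
    (nilpBracket F n X Y).1 = X.1 * Y.1 - Y.1 * X.1 := rfl

/-- The bilinear form `(X, Y) ↦ f([X, Y])` on `𝔲`. -/
def kirillovForm (f : Module.Dual F (nilp F n)) : nilp F n →ₗ[F] Module.Dual F (nilp F n) :=
  (nilpBracket F n).compr₂ f

@[simp] theorem kirillovForm_apply (f : Module.Dual F (nilp F n)) (X Y : nilp F n) :
    kirillovForm f X Y = f (nilpBracket F n X Y) := rfl

theorem kirillovForm_skew (f : Module.Dual F (nilp F n)) (X Y : nilp F n) :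
    kirillovForm f X Y = -kirillovForm f Y X := by
  rw [kirillovForm_apply, kirillovForm_apply, ← map_neg]
  congr 1
  exact Subtype.ext (by simp)

theorem coadjointRep_apply (g : unip F n) (f : Module.Dual F (nilp F n)) (X : nilp F n) :
    coadjointRep F n g f X = f (adjointRep F n g⁻¹ X) := rfl

theorem coe_adjointRep_inv (g : unip F n) (X : nilp F n) :
    (adjointRep F n g⁻¹ X).1 = (g⁻¹).1.1 * X.1 * g.1.1 := by
  change (g⁻¹).1.1 * X.1 * ((g⁻¹)⁻¹).1.1 = _
  rw [inv_inv]

theorem coe_inv_mul (g : unip F n) : (g⁻¹).1.1 * g.1.1 = 1 :=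
  congrArg (fun h : unip F n => h.1.1) (inv_mul_cancel g)

/-- Although `1 + X` need not be symplectic, `1 + X` and `1 - X` are adjoint to each other for the
symplectic form, which suffices. -/
theorem one_add_mul_mul_one_sub_mem_nilp {X Y : Matrix (Fin n ⊕ Fin n) (Fin n ⊕ Fin n) F}
    (hX : X ∈ nilp F n) (hY : Y ∈ nilp F n) : (1 + X) * Y * (1 - X) ∈ nilp F n := by
  refine mem_nilp_iff.2 ⟨?_, ((isUnitLower_one_add hX).isLower.mul_isStrictLower
    (isStrictLower_of_mem_nilp hY)).mul_isLower (isUnitLower_one_sub hX).isLower⟩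
  have h1 := transpose_mul_J_of_mem_nilp hX
  have h2 := transpose_mul_J_of_mem_nilp hY
  have e1 : (1 + X)ᵀ * J (Fin n) F = J (Fin n) F * (1 - X) := by
    rw [transpose_add, transpose_one, add_mul, h1, mul_sub, one_mul, mul_one, sub_eq_add_neg]
  have e2 : (1 - X)ᵀ * J (Fin n) F = J (Fin n) F * (1 + X) := by
    simp [sub_mul, mul_add, h1]
  rw [mem_sp_iff, transpose_mul, transpose_mul, mul_assoc, mul_assoc, e1, ← mul_assoc Yᵀ, h2,
    Matrix.neg_mul, Matrix.mul_neg, ← mul_assoc, ← mul_assoc, e2]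
  simp only [mul_assoc]

/-- With `c` the Cayley transform of `x` and `TY = (1 + x)Y(1 - x)`, one gets `c⁻¹(TY)c = (1 - x)Y(1
+ x)`, and this differs from `TY` by exactly `-2[x, Y]`. Since `T` is onto, `c` fixes `f` iff `x`
lies in the kernel. Unlike the exponential, this needs only that `2` is invertible. -/
theorem coadjointRep_cayley_eq_self_iff [Finite F] (h2 : (2 : F) ≠ 0)
    (f : Module.Dual F (nilp F n)) (x : nilp F n) :
    coadjointRep F n (cayley h2 x) f = f ↔ x ∈ LinearMap.ker (kirillovForm f) := by
  let T : nilp F n → nilp F n := fun Y =>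
    ⟨(1 + x.1) * Y.1 * (1 - x.1), one_add_mul_mul_one_sub_mem_nilp x.2 Y.2⟩
  have hT : T.Surjective := by
    refine Finite.injective_iff_surjective.1 fun Y Z h => Subtype.ext ?_
    have h' : (1 + x.1) * Y.1 * (1 - x.1) = (1 + x.1) * Z.1 * (1 - x.1) :=
      congrArg Subtype.val h
    have hp := (isUnitLower_one_add x.2).isUnit_det pos_injective
    have hm := (isUnitLower_one_sub x.2).isUnit_det pos_injective
    have h3 := congrArg (fun M => M * (1 - x.1)⁻¹) h'
    simp only [Matrix.mul_nonsing_inv_cancel_right _ _ hm] at h3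
    have h4 := congrArg (fun M => (1 + x.1)⁻¹ * M) h3
    simpa only [Matrix.nonsing_inv_mul_cancel_left _ _ hp] using h4
  have key : ∀ Y, coadjointRep F n (cayley h2 x) f (T Y) - f (T Y) =
      -2 * kirillovForm f x Y := by
    intro Y
    rw [coadjointRep_apply, kirillovForm_apply, ← map_sub, ← smul_eq_mul, ← map_smul]
    congr 1
    refine Subtype.ext ?_
    have hl : ((cayley h2 x)⁻¹).1.1 * (1 + x.1) = 1 - x.1 := by
      rw [← cayley_mul_one_sub h2 x, ← mul_assoc, coe_inv_mul, one_mul]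
    have e : (adjointRep F n (cayley h2 x)⁻¹ (T Y)).1 = (1 - x.1) * Y.1 * (1 + x.1) := by
      rw [coe_adjointRep_inv]
      change _ * ((1 + x.1) * Y.1 * (1 - x.1)) * _ = _
      rw [mul_assoc, mul_assoc _ _ (cayley h2 x).1.1, one_sub_mul_cayley, ← mul_assoc,
        ← mul_assoc, hl]
    rw [Submodule.coe_sub, e]
    change (1 - x.1) * Y.1 * (1 + x.1) - (1 + x.1) * Y.1 * (1 - x.1) =
      (-2 : F) • (x.1 * Y.1 - Y.1 * x.1)
    rw [neg_smul, two_smul]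
    noncomm_ring
  rw [LinearMap.mem_ker]
  constructor
  · intro h
    ext Y
    have := key Y
    rw [h, sub_self] at this
    exact (mul_eq_zero.1 this.symm).resolve_left (neg_ne_zero.2 h2)
  · intro h
    ext X
    obtain ⟨Y, rfl⟩ := hT X
    have := key Y
    rw [h, LinearMap.zero_apply, mul_zero] at this
    exact sub_eq_zero.1 this

/-- Orbit-stabilizer, with the group and the stabilizer counted through the Cayley transform. -/
theorem hasDim_coadjointOrbit [Finite F] (h2 : (2 : F) ≠ 0) (f : Module.Dual F (nilp F n)) :
    HasDim (coadjointOrbit f) (Module.finrank F (LinearMap.range (kirillovForm f))) := by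
  let _ : MulAction (unip F n) (Module.Dual F (nilp F n)) :=
    { smul := fun g f => coadjointRep F n g f
      one_smul := fun f => by change coadjointRep F n 1 f = f; simp
      mul_smul := fun g h f => by
        change coadjointRep F n (g * h) f = coadjointRep F n g (coadjointRep F n h f); simp }
  have h1 := Subgroup.card_mul_index (MulAction.stabilizer (unip F n) f)
  rw [MulAction.index_stabilizer] at h1
  have h3 : Nat.card (MulAction.stabilizer (unip F n) f) =
      Nat.card (LinearMap.ker (kirillovForm f)) :=
    (Nat.card_congr ((cayley h2).subtypeEquiv fun x =>
      (coadjointRep_cayley_eq_self_iff h2 f x).symm)).symm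
  have h4 := LinearMap.finrank_range_add_finrank_ker (kirillovForm f)
  have hq : 0 < Nat.card F := Nat.card_pos
  rw [h3, ← Nat.card_congr (cayley h2), Module.natCard_eq_pow_finrank (K := F),
    Module.natCard_eq_pow_finrank (K := F) (V := nilp F n), ← h4, pow_add, mul_comm] at h1
  exact Nat.eq_of_mul_eq_mul_right (pow_pos hq _) h1

end Cayley

/-! ### The abelian ideal, the symmetric matrix of a form, and the action of `U` on it. -/

section Blocks

variable {F : Type*} [Field F] {n : ℕ}

theorem fromBlocks_mem_nilp {A C : Matrix (Fin n) (Fin n) F} (hA : IsStrictLower Fin.val A)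
    (hC : Cᵀ = C) : fromBlocks A 0 C (-Aᵀ) ∈ nilp F n := by
  refine mem_nilp_iff.2 ⟨mem_sp_iff_apply.2 ⟨fun a b => by simp, fun a b => ?_, fun a b => by simp⟩,
    ?_⟩
  · exact congrFun (congrFun hC.symm a) b
  · rintro (a | a) (b | b) h
    · exact hA a b h
    · rfl
    · simp only [pos] at h; omega
    · have : A b a = 0 := hA b a (by simp only [pos] at h; omega)
      simp [this]

theorem toBlocks₁₁_isStrictLower (X : nilp F n) : IsStrictLower Fin.val X.1.toBlocks₁₁ :=
  fun _ _ h => isStrictLower_of_mem_nilp X.2 _ _ h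

theorem transpose_toBlocks₂₁ (X : nilp F n) : X.1.toBlocks₂₁ᵀ = X.1.toBlocks₂₁ := by
  ext a b
  exact (mem_sp_iff_apply.1 (mem_nilp_iff.1 X.2).1).2.1 b a

theorem eq_fromBlocks (X : nilp F n) :
    X.1 = fromBlocks X.1.toBlocks₁₁ 0 X.1.toBlocks₂₁ (-X.1.toBlocks₁₁ᵀ) := by
  conv_lhs => rw [← fromBlocks_toBlocks X.1]
  congr 1
  · ext a b
    exact isStrictLower_of_mem_nilp X.2 _ _ (by simp only [pos]; omega)
  · ext a b
    exact (mem_sp_iff_apply.1 (mem_nilp_iff.1 X.2).1).1 a b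

variable (F n) in
/-- The projection of `𝔲` onto its strictly lower triangular upper left block. -/
def leviPart : nilp F n →ₗ[F] Matrix (Fin n) (Fin n) F where
  toFun X := X.1.toBlocks₁₁
  map_add' _ _ := rfl
  map_smul' _ _ := rfl

theorem leviPart_apply (X : nilp F n) : leviPart F n X = X.1.toBlocks₁₁ := rfl

variable (F n) in
/-- The abelian ideal of `𝔲` spanned by the root vectors of the roots `2ε_i` and `ε_i + ε_j`. -/
def siegelIdeal : Submodule F (nilp F n) := LinearMap.ker (leviPart F n)

theorem mem_siegelIdeal {X : nilp F n} : X ∈ siegelIdeal F n ↔ X.1.toBlocks₁₁ = 0 := Iff.rfl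

variable (F n) in
/-- The map sending `C` to the element of `𝔲` with lower left block `C + Cᵀ`. -/
def symEmb : Matrix (Fin n) (Fin n) F →ₗ[F] nilp F n where
  toFun C := ⟨fromBlocks 0 0 (C + Cᵀ) 0, by
    simpa using fromBlocks_mem_nilp (A := (0 : Matrix (Fin n) (Fin n) F)) (C := C + Cᵀ)
      (fun _ _ _ => rfl) (by simp [add_comm])⟩
  map_add' C D := Subtype.ext (by
    simp [fromBlocks_add]; abel)
  map_smul' c C := Subtype.ext (by simp [fromBlocks_smul])

theorem coe_symEmb (C : Matrix (Fin n) (Fin n) F) :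
    (symEmb F n C).1 = fromBlocks 0 0 (C + Cᵀ) 0 := rfl

theorem symEmb_mem (C : Matrix (Fin n) (Fin n) F) : symEmb F n C ∈ siegelIdeal F n := by
  rw [mem_siegelIdeal, coe_symEmb, toBlocks_fromBlocks₁₁]

theorem symEmb_transpose (C : Matrix (Fin n) (Fin n) F) : symEmb F n Cᵀ = symEmb F n C :=
  Subtype.ext (by simp [coe_symEmb, add_comm])

theorem exists_symEmb_eq (h2 : (2 : F) ≠ 0) {X : nilp F n} (hX : X ∈ siegelIdeal F n) :
    ∃ C, symEmb F n C = X := by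
  refine ⟨(2⁻¹ : F) • X.1.toBlocks₂₁, Subtype.ext ?_⟩
  rw [eq_fromBlocks X, mem_siegelIdeal.1 hX, coe_symEmb, toBlocks_fromBlocks₂₁, transpose_smul,
    transpose_toBlocks₂₁, ← add_smul, ← two_mul, mul_inv_cancel₀ h2, one_smul]
  simp

theorem two_mul_finrank_range_leviPart :
    2 * Module.finrank F (LinearMap.range (leviPart F n)) = n * (n - 1) := by
  let φ : LinearMap.range (leviPart F n) →ₗ[F] ((Σ i : Fin n, Fin i) → F) :=
    { toFun := fun A p => A.1 p.1 (p.2.castLE p.1.2.le)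
      map_add' := fun _ _ => rfl
      map_smul' := fun _ _ => rfl }
  have hφ : Function.Bijective φ := by
    constructor
    · rintro ⟨_, X, rfl⟩ ⟨_, Y, rfl⟩ h
      refine Subtype.ext ?_
      ext i j
      rcases le_or_gt (i : ℕ) j with hij | hij
      · exact (toBlocks₁₁_isStrictLower X i j hij).trans (toBlocks₁₁_isStrictLower Y i j hij).symm
      · exact congrFun h ⟨i, ⟨j, hij⟩⟩
    · intro ψ
      let A : Matrix (Fin n) (Fin n) F :=
        .of fun i j => if h : (j : ℕ) < i then ψ ⟨i, ⟨j, h⟩⟩ else 0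
      have hA : IsStrictLower Fin.val A := fun i j hij => dif_neg (not_lt.2 hij)
      refine ⟨⟨A, ⟨_, fromBlocks_mem_nilp (C := 0) hA (by simp)⟩, ?_⟩, ?_⟩
      · rw [leviPart_apply, toBlocks_fromBlocks₁₁]
      · ext ⟨i, j⟩
        exact dif_pos j.2
  rw [(LinearEquiv.ofBijective φ hφ).finrank_eq, Module.finrank_fintype_fun_eq_card,
    Fintype.card_sigma]
  simp only [Fintype.card_fin]
  rw [Fin.sum_univ_eq_sum_range (fun i => i), mul_comm, Finset.sum_range_id_mul_two]

theorem two_mul_finrank_nilp :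
    2 * Module.finrank F (nilp F n) = n * (n - 1) + 2 * Module.finrank F (siegelIdeal F n) := by
  rw [← LinearMap.finrank_range_add_finrank_ker (leviPart F n), mul_add,
    two_mul_finrank_range_leviPart]
  rfl

/-- The symmetric matrix describing the restriction of a linear form to `siegelIdeal`. -/
def quadPart (f : Module.Dual F (nilp F n)) : Matrix (Fin n) (Fin n) F :=
  .of fun i j => f (symEmb F n (Matrix.single i j 1))

theorem quadPart_isSymm (f : Module.Dual F (nilp F n)) : (quadPart f).IsSymm := by
  ext i j
  simp only [quadPart, transpose_apply, of_apply]
  rw [← symEmb_transpose, transpose_single]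

theorem apply_symEmb (f : Module.Dual F (nilp F n)) (C : Matrix (Fin n) (Fin n) F) :
    f (symEmb F n C) = (C * quadPart f).trace := by
  have e : f ∘ₗ symEmb F n =
      Matrix.traceLinearMap _ F F ∘ₗ LinearMap.mulRight F (quadPart f) := by
    refine Matrix.ext_linearMap F fun i j => LinearMap.ext_ring ?_
    simp only [LinearMap.comp_apply, singleLinearMap_apply, LinearMap.mulRight_apply,
      traceLinearMap_apply, trace_single_mul, (quadPart_isSymm f).apply i j]
    exact (one_smul F _).symm
  exact LinearMap.congr_fun e C

theorem eq_of_forall_trace_mul {P Q : Matrix (Fin n) (Fin n) F}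
    (h : ∀ C : Matrix (Fin n) (Fin n) F, (C * P).trace = (C * Q).trace) : P = Q := by
  ext i j
  simpa [Matrix.trace_single_mul] using h (Matrix.single j i 1)

/-- With `S = C + Cᵀ` and `A` the upper left block of `X`, the lower left block of the bracket is
`SA + AᵀS = SA + (SA)ᵀ`. -/
theorem nilpBracket_symEmb (C : Matrix (Fin n) (Fin n) F) (X : nilp F n) :
    nilpBracket F n (symEmb F n C) X = symEmb F n ((C + Cᵀ) * X.1.toBlocks₁₁) := by
  refine Subtype.ext ?_
  rw [coe_nilpBracket, coe_symEmb, coe_symEmb, eq_fromBlocks X, fromBlocks_multiply,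
    fromBlocks_multiply, toBlocks_fromBlocks₁₁, sub_eq_add_neg, fromBlocks_neg, fromBlocks_add]
  simp [add_comm]

theorem kirillovForm_symEmb (f : Module.Dual F (nilp F n)) (C : Matrix (Fin n) (Fin n) F)
    (X : nilp F n) : kirillovForm f (symEmb F n C) X =
      (C * (X.1.toBlocks₁₁ * quadPart f + (X.1.toBlocks₁₁ * quadPart f)ᵀ)).trace := by
  rw [kirillovForm_apply, nilpBracket_symEmb, apply_symEmb, mul_add, add_mul, add_mul, trace_add,
    trace_add, mul_assoc, mul_assoc]
  congr 1
  rw [← trace_transpose, transpose_mul, transpose_transpose, trace_mul_comm]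

theorem kirillovForm_siegelIdeal (h2 : (2 : F) ≠ 0) (f : Module.Dual F (nilp F n)) :
    ∀ X ∈ siegelIdeal F n, ∀ Y ∈ siegelIdeal F n, kirillovForm f X Y = 0 := by
  intro X hX Y hY
  obtain ⟨C, rfl⟩ := exists_symEmb_eq h2 hX
  rw [kirillovForm_symEmb, mem_siegelIdeal.1 hY]
  simp

/-- By nondegeneracy of the trace pairing, `X` is orthogonal to the ideal iff `AQ` is
skew-symmetric, where `A` is its upper left block. -/
theorem orthComp_siegelIdeal_le_iff (h2 : (2 : F) ≠ 0) (f : Module.Dual F (nilp F n)) :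
    orthComp (kirillovForm f) (siegelIdeal F n) ≤ siegelIdeal F n ↔ IsRegular (quadPart f) := by
  have key : ∀ X : nilp F n, X ∈ orthComp (kirillovForm f) (siegelIdeal F n) ↔
      X.1.toBlocks₁₁ * quadPart f + (X.1.toBlocks₁₁ * quadPart f)ᵀ = 0 := by
    intro X
    rw [mem_orthComp]
    constructor
    · intro h
      refine eq_of_forall_trace_mul fun C => ?_
      rw [← kirillovForm_symEmb, h _ (symEmb_mem C)]
      simp
    · intro h w hw
      obtain ⟨C, rfl⟩ := exists_symEmb_eq h2 hw
      rw [kirillovForm_symEmb, h]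
      simp
  constructor
  · intro h A hA hAQ
    let X : nilp F n := ⟨_, fromBlocks_mem_nilp (C := 0) hA (by simp)⟩
    have hX : X.1.toBlocks₁₁ = A := toBlocks_fromBlocks₁₁ _ _ _ _
    rw [← hX] at hAQ ⊢
    exact h ((key X).2 hAQ)
  · intro h X hX
    exact h _ (toBlocks₁₁_isStrictLower X) ((key X).1 hX)

theorem finrank_range_kirillovForm_le (h2 : (2 : F) ≠ 0) (f : Module.Dual F (nilp F n)) :
    Module.finrank F (LinearMap.range (kirillovForm f)) ≤ n * (n - 1) := by
  have h1 := finrank_range_add_le (kirillovForm_siegelIdeal h2 f)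
  have h3 := two_mul_finrank_nilp (F := F) (n := n)
  omega

theorem finrank_range_kirillovForm_eq_iff (h2 : (2 : F) ≠ 0) (f : Module.Dual F (nilp F n)) :
    Module.finrank F (LinearMap.range (kirillovForm f)) = n * (n - 1) ↔
      IsRegular (quadPart f) := by
  rw [← orthComp_siegelIdeal_le_iff h2, ← finrank_range_add_eq_iff (kirillovForm_skew f)
    (kirillovForm_siegelIdeal h2 f), two_mul_finrank_nilp]
  omega

theorem toBlocks₁₁_isUnitLower (g : unip F n) : IsUnitLower Fin.val g.1.1.toBlocks₁₁ :=
  ⟨fun i j h => g.2.1 (.inl i) (.inl j) h, fun i => g.2.2 (.inl i)⟩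

theorem unip_eq_fromBlocks (g : unip F n) :
    g.1.1 = fromBlocks g.1.1.toBlocks₁₁ 0 g.1.1.toBlocks₂₁ g.1.1.toBlocks₂₂ := by
  conv_lhs => rw [← fromBlocks_toBlocks g.1.1]
  congr 1
  ext a b
  exact g.2.1 _ _ (by simp only [pos]; omega)

theorem unip_inv_eq_fromBlocks (g : unip F n) :
    (g⁻¹).1.1 = fromBlocks g.1.1.toBlocks₂₂ᵀ 0 (-g.1.1.toBlocks₂₁ᵀ) g.1.1.toBlocks₁₁ᵀ := by
  change (g.1⁻¹).1 = _
  rw [SymplecticGroup.coe_inv]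
  conv_lhs => rw [unip_eq_fromBlocks g]
  simp [J, fromBlocks_transpose, fromBlocks_multiply, fromBlocks_neg]

theorem adjointRep_inv_symEmb (g : unip F n) (C : Matrix (Fin n) (Fin n) F) :
    adjointRep F n g⁻¹ (symEmb F n C) =
      symEmb F n (g.1.1.toBlocks₁₁ᵀ * C * g.1.1.toBlocks₁₁) := by
  refine Subtype.ext ?_
  rw [coe_adjointRep_inv, unip_inv_eq_fromBlocks, coe_symEmb, coe_symEmb]
  conv_lhs => enter [2]; rw [unip_eq_fromBlocks g]
  rw [fromBlocks_multiply, fromBlocks_multiply]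
  simp [mul_add, add_mul, mul_assoc]

theorem quadPart_coadjointRep (g : unip F n) (f : Module.Dual F (nilp F n)) :
    quadPart (coadjointRep F n g f) =
      g.1.1.toBlocks₁₁ * quadPart f * g.1.1.toBlocks₁₁ᵀ := by
  refine eq_of_forall_trace_mul fun C => ?_
  rw [← apply_symEmb, coadjointRep_apply, adjointRep_inv_symEmb, apply_symEmb, mul_assoc,
    mul_assoc, trace_mul_comm]
  simp only [mul_assoc]

/-- The element of `U` with diagonal blocks `a` and `(a⁻¹)ᵀ`. -/
noncomputable def leviElement (a : Matrix (Fin n) (Fin n) F) (ha : IsUnitLower Fin.val a) :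
    unip F n :=
  ⟨⟨fromBlocks a 0 0 a⁻¹ᵀ, by
    have h : a * a⁻¹ = 1 := Matrix.mul_nonsing_inv _ (ha.isUnit_det Fin.val_injective)
    have h' : a⁻¹ᵀ * aᵀ = 1 := by rw [← transpose_mul, h, transpose_one]
    rw [SymplecticGroup.mem_iff]
    simp [J, fromBlocks_transpose, fromBlocks_multiply, h, h']⟩, by
    have hb := ha.inv Fin.val_injective
    constructor
    · rintro (i | i) (j | j) h
      · exact ha.1 i j h
      · rfl
      · rfl
      · exact hb.1 j i (by simp only [pos] at h; omega)
    · rintro (i | i)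
      · exact ha.2 i
      · exact hb.2 i⟩

/-- The element of `U` with diagonal blocks `1` and lower left block `S`. -/
def siegelElement (S : Matrix (Fin n) (Fin n) F) (hS : Sᵀ = S) : unip F n :=
  ⟨⟨fromBlocks 1 0 S 1, by
    rw [SymplecticGroup.mem_iff]
    simp [J, fromBlocks_transpose, fromBlocks_multiply, hS]⟩, by
    constructor
    · rintro (i | i) (j | j) h
      · exact isLower_one (p := Fin.val) i j h
      · rfl
      · simp only [pos] at h; omega
      · exact Matrix.one_apply_ne (by rintro rfl; exact lt_irrefl _ h)
    · rintro (i | i)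
      · exact Matrix.one_apply_eq i
      · exact Matrix.one_apply_eq i⟩

/-- With `N = symEmb F n C`, the conjugate `(1 + N)X(1 - N)` equals `X + [N, X]` exactly: the
quadratic term `NXN` vanishes because the upper right block of `X` is zero. -/
theorem coadjointRep_siegelElement (f : Module.Dual F (nilp F n)) (C : Matrix (Fin n) (Fin n) F)
    (hC : (-(C + Cᵀ))ᵀ = -(C + Cᵀ)) :
    coadjointRep F n (siegelElement (-(C + Cᵀ)) hC) f = f + kirillovForm f (symEmb F n C) := by
  ext X
  rw [coadjointRep_apply, LinearMap.add_apply, kirillovForm_apply, ← map_add]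
  congr 1
  refine Subtype.ext ?_
  rw [coe_adjointRep_inv, unip_inv_eq_fromBlocks, nilpBracket_symEmb, Submodule.coe_add,
    coe_symEmb]
  change fromBlocks 1ᵀ 0 (-(-(C + Cᵀ))ᵀ) 1ᵀ * X.1 * fromBlocks 1 0 (-(C + Cᵀ)) 1 = _
  conv_lhs => rw [eq_fromBlocks X, hC]
  conv_rhs => rw [eq_fromBlocks X]
  rw [fromBlocks_multiply, fromBlocks_multiply, fromBlocks_add, toBlocks_fromBlocks₁₁]
  simp
  noncomm_ring

theorem coadjointOrbit_subset {f f' : Module.Dual F (nilp F n)} (h : f' ∈ coadjointOrbit f) :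
    coadjointOrbit f' ⊆ coadjointOrbit f := by
  obtain ⟨g, rfl⟩ := h
  rintro _ ⟨k, rfl⟩
  exact ⟨k * g, by simp⟩

theorem coadjointOrbit_eq_of_mem {f f' : Module.Dual F (nilp F n)} (h : f' ∈ coadjointOrbit f) :
    coadjointOrbit f' = coadjointOrbit f := by
  refine (coadjointOrbit_subset h).antisymm (coadjointOrbit_subset ?_)
  obtain ⟨g, rfl⟩ := h
  refine ⟨g⁻¹, ?_⟩
  change (coadjointRep F n g⁻¹ * coadjointRep F n g) f = f
  rw [← map_mul]; simp

theorem exists_quadPart_eq_of_mem {f f' : Module.Dual F (nilp F n)} (h : f' ∈ coadjointOrbit f) :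
    ∃ a, IsUnitLower Fin.val a ∧ quadPart f' = a * quadPart f * aᵀ := by
  obtain ⟨g, rfl⟩ := h
  exact ⟨_, toBlocks₁₁_isUnitLower g, quadPart_coadjointRep g f⟩

/-- The difference `f' - f` annihilates the ideal, so regularity writes it as `B_f(N, ·)` with `N`
in the ideal, and the corresponding unipotent element moves `f` to `f'`. -/
theorem mem_coadjointOrbit_of_quadPart_eq (h2 : (2 : F) ≠ 0) {f f' : Module.Dual F (nilp F n)}
    (hf : IsRegular (quadPart f)) (h : quadPart f' = quadPart f) : f' ∈ coadjointOrbit f := by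
  have h1 : f' - f ∈ (siegelIdeal F n).dualAnnihilator := by
    rw [Submodule.mem_dualAnnihilator]
    intro X hX
    obtain ⟨C, rfl⟩ := exists_symEmb_eq h2 hX
    rw [LinearMap.sub_apply, apply_symEmb, apply_symEmb, h, sub_self]
  rw [← map_eq_dualAnnihilator (kirillovForm_siegelIdeal h2 f)
    ((orthComp_siegelIdeal_le_iff h2 f).2 hf)] at h1
  obtain ⟨X, hX, hXf⟩ := h1
  obtain ⟨C, rfl⟩ := exists_symEmb_eq h2 hX
  refine ⟨siegelElement (-(C + Cᵀ)) (by simp [add_comm]), ?_⟩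
  change coadjointRep F n _ f = f'
  rw [coadjointRep_siegelElement, hXf]
  abel

theorem mem_coadjointOrbit_of_congruent (h2 : (2 : F) ≠ 0) {f f' : Module.Dual F (nilp F n)}
    (hf : IsRegular (quadPart f)) {a : Matrix (Fin n) (Fin n) F} (ha : IsUnitLower Fin.val a)
    (h : quadPart f' = a * quadPart f * aᵀ) : f' ∈ coadjointOrbit f := by
  have e : quadPart (coadjointRep F n (leviElement a ha) f) = a * quadPart f * aᵀ := by
    rw [quadPart_coadjointRep]
    change (fromBlocks a 0 0 a⁻¹ᵀ).toBlocks₁₁ * _ * (fromBlocks a 0 0 a⁻¹ᵀ).toBlocks₁₁ᵀ = _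
    rw [toBlocks_fromBlocks₁₁]
  exact coadjointOrbit_subset ⟨leviElement a ha, rfl⟩
    (mem_coadjointOrbit_of_quadPart_eq h2 (e ▸ hf.congr ha) (h.trans e.symm))

end Blocks

/-! ### Canonical matrices and the forms `f_{D,ξ}`. -/

section CanonicalForms

variable {F : Type*} [Field F] {n : ℕ}

theorem PosRoot.Orthogonal.symm {α β : PosRoot n} (h : α.Orthogonal β) : β.Orthogonal α := by
  rw [PosRoot.Orthogonal, dotProduct_comm]; exact h

theorem orthogonal_long_long {i j : Fin n} (h : i ≠ j) :
    (PosRoot.long i).Orthogonal (PosRoot.long j) := by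
  simp [PosRoot.Orthogonal, PosRoot.toVec, h]

theorem orthogonal_long_add_iff {i j k : Fin n} (h : i < j) :
    (PosRoot.long k).Orthogonal (PosRoot.add i j h) ↔ k ≠ i ∧ k ≠ j := by
  simp only [PosRoot.Orthogonal, PosRoot.toVec, smul_dotProduct, single_dotProduct, Pi.add_apply,
    Pi.single_apply, one_mul, smul_eq_mul]
  split_ifs <;> simp_all

theorem orthogonal_add_add_iff {i j k l : Fin n} (h : i < j) (h' : k < l) :
    (PosRoot.add i j h).Orthogonal (PosRoot.add k l h') ↔ i ≠ k ∧ i ≠ l ∧ j ≠ k ∧ j ≠ l := by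
  simp only [PosRoot.Orthogonal, PosRoot.toVec, add_dotProduct, single_dotProduct, Pi.add_apply,
    Pi.single_apply, one_mul]
  split_ifs <;> simp_all

theorem symEmb_single_self (i : Fin n) :
    symEmb F n (Matrix.single i i 1) = (2 : F) • ⟨rootVec F (.long i), rootVec_mem _⟩ := by
  refine Subtype.ext ?_
  rw [coe_symEmb, Submodule.coe_smul]
  ext (a | a) (b | b) <;> simp [rootVec, Matrix.single_apply]
  split_ifs <;> norm_num

theorem symEmb_single_of_lt {i j : Fin n} (h : i < j) :
    symEmb F n (Matrix.single i j 1) = ⟨rootVec F (.add i j h), rootVec_mem _⟩ := by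
  refine Subtype.ext ?_
  rw [coe_symEmb]
  ext (a | a) (b | b) <;> simp [rootVec, Matrix.single_apply]
  rw [add_comm]

theorem quadPart_self (f : Module.Dual F (nilp F n)) (i : Fin n) :
    quadPart f i i = 2 * f ⟨rootVec F (.long i), rootVec_mem _⟩ := by
  simp only [quadPart, of_apply]
  rw [symEmb_single_self, map_smul, smul_eq_mul]

theorem quadPart_of_lt (f : Module.Dual F (nilp F n)) {i j : Fin n} (h : i < j) :
    quadPart f i j = f ⟨rootVec F (.add i j h), rootVec_mem _⟩ := by
  simp only [quadPart, of_apply]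
  rw [symEmb_single_of_lt h]

open Classical in
theorem canonicalForm_rootVec (h2 : (2 : F) ≠ 0) (D : Finset (PosRoot n)) (ξ : PosRoot n → F)
    (α : PosRoot n) :
    canonicalForm D ξ ⟨rootVec F α, rootVec_mem α⟩ = if α ∈ D then ξ α else 0 := by
  simp only [canonicalForm, LinearMap.sum_apply, LinearMap.smul_apply, dualVec_rootVec h2,
    smul_eq_mul, mul_ite, mul_one, mul_zero, Finset.sum_ite_eq']

theorem dual_ext {f f' : Module.Dual F (nilp F n)}
    (h : ∀ α, f ⟨rootVec F α, rootVec_mem α⟩ = f' ⟨rootVec F α, rootVec_mem α⟩) : f = f' := by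
  ext ⟨X, hX⟩
  induction hX using Submodule.span_induction with
  | mem x hx => obtain ⟨α, rfl⟩ := hx; exact h α
  | zero => exact (map_zero f).trans (map_zero f').symm
  | add x y hx hy ihx ihy =>
    have e : (⟨x + y, add_mem hx hy⟩ : nilp F n) = ⟨x, hx⟩ + ⟨y, hy⟩ := rfl
    rw [e, map_add, map_add, ihx, ihy]
  | smul c x hx ih =>
    have e : (⟨c • x, Submodule.smul_mem _ c hx⟩ : nilp F n) = c • ⟨x, hx⟩ := rfl
    rw [e, map_smul, map_smul, ih]

/-- The matrix records the values on all root vectors of `2ε_i` and `ε_i + ε_j`, and `D_reg`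
contains no root `ε_i - ε_j`. -/
theorem canonicalForm_ext (h2 : (2 : F) ≠ 0) {D D' : Finset (PosRoot n)} {ξ ξ' : PosRoot n → F}
    (hD : IsOrthogonalSubset D) (hD' : IsOrthogonalSubset D')
    (h : quadPart (canonicalForm D ξ) = quadPart (canonicalForm D' ξ')) :
    canonicalForm D ξ = canonicalForm D' ξ' := by
  classical
  have hsub : ∀ (E : Finset (PosRoot n)), IsOrthogonalSubset E →
      ∀ i j hij, PosRoot.sub i j hij ∉ E := by
    intro E hE i j hij hmem
    rcases hE.1 hmem with ⟨k, hk⟩ | ⟨k, l, _, _, hk⟩ <;> cases hk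
  refine dual_ext fun α => ?_
  rcases α with i | ⟨i, j, hij⟩ | ⟨i, j, hij⟩
  · have := congrFun (congrFun h i) i
    rw [quadPart_self, quadPart_self] at this
    exact mul_left_cancel₀ h2 this
  · rw [canonicalForm_rootVec h2, canonicalForm_rootVec h2, if_neg (hsub D hD i j hij),
      if_neg (hsub D' hD' i j hij)]
  · rw [← quadPart_of_lt, ← quadPart_of_lt, h]

/-- If no root of `D` involved the index `i`, then `2ε_i` could be added to `D`. -/
theorem IsMaximalOrthogonal.exists_mem {D : Finset (PosRoot n)} (hD : IsMaximalOrthogonal D)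
    (i : Fin n) : .long i ∈ D ∨ ∃ (j k : Fin n) (h : j < k), .add j k h ∈ D ∧ (i = j ∨ i = k) := by
  classical
  by_contra! hcon
  obtain ⟨h1, h3⟩ := hcon
  have hle : insert (.long i) D ≤ D := by
    refine hD.2 ⟨?_, ?_⟩ (Finset.subset_insert _ _)
    · rw [Finset.coe_insert]
      exact Set.insert_subset (Or.inl ⟨i, rfl⟩) hD.1.1
    · rw [Finset.coe_insert]
      refine Set.pairwise_insert.2 ⟨hD.1.2, fun β hβ hne => ?_⟩
      rw [and_iff_left_of_imp PosRoot.Orthogonal.symm]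
      rcases hD.1.1 hβ with ⟨k, rfl⟩ | ⟨k, l, hkl, _, rfl⟩
      · exact orthogonal_long_long fun e => hne (by rw [e])
      · exact (orthogonal_long_add_iff hkl).2 (h3 k l hkl hβ)
  exact h1 (hle (Finset.mem_insert_self _ _))

theorem isCanonical_quadPart (h2 : (2 : F) ≠ 0) {D : Finset (PosRoot n)} {ξ : PosRoot n → F}
    (hD : IsMaximalOrthogonal D) (hξ : IsAdmissible D ξ) :
    IsCanonical (quadPart (canonicalForm D ξ)) := by
  classical
  have hsymm := quadPart_isSymm (canonicalForm D ξ)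
  have hself : ∀ i, quadPart (canonicalForm D ξ) i i ≠ 0 → .long i ∈ D := by
    intro i hi
    by_contra hmem
    rw [quadPart_self, canonicalForm_rootVec h2, if_neg hmem, mul_zero] at hi
    exact hi rfl
  have hlt : ∀ i j (h : i < j), quadPart (canonicalForm D ξ) i j ≠ 0 → .add i j h ∈ D := by
    intro i j h hij
    by_contra hmem
    rw [quadPart_of_lt _ h, canonicalForm_rootVec h2, if_neg hmem] at hij
    exact hij rfl
  have hadd : ∀ (i j : Fin n) (h : i < j), .add i j h ∈ D → (i : ℕ) + 1 = j := by
    intro i j h hmem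
    rcases hD.1.1 hmem with ⟨k, hk⟩ | ⟨k, l, _, hkl, hk⟩
    · cases hk
    · cases hk; exact hkl
  have hex : ∀ i j, quadPart (canonicalForm D ξ) i j ≠ 0 → (i = j ∧ .long i ∈ D) ∨
      ∃ (k l : Fin n) (h : k < l), .add k l h ∈ D ∧ ((i = k ∧ j = l) ∨ (i = l ∧ j = k)) := by
    intro i j hij
    rcases lt_trichotomy i j with h | rfl | h
    · exact Or.inr ⟨i, j, h, hlt i j h hij, Or.inl ⟨rfl, rfl⟩⟩
    · exact Or.inl ⟨rfl, hself i hij⟩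
    · exact Or.inr ⟨j, i, h, hlt j i h (by rwa [hsymm.apply]), Or.inr ⟨rfl, rfl⟩⟩
  have hla : ∀ (i k l : Fin n) (h : k < l), .long i ∈ D → .add k l h ∈ D → i ≠ k ∧ i ≠ l :=
    fun i k l h hi hkl => (orthogonal_long_add_iff h).1 (hD.1.2 hi hkl (by simp))
  have haa : ∀ (i j k l : Fin n) (h : i < j) (h' : k < l), .add i j h ∈ D → .add k l h' ∈ D →
      (i = k ∧ j = l) ∨ (i ≠ k ∧ i ≠ l ∧ j ≠ k ∧ j ≠ l) := by
    intro i j k l h h' hm hm'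
    by_cases e : i = k ∧ j = l
    · exact Or.inl e
    · exact Or.inr ((orthogonal_add_add_iff h h').1 (hD.1.2 hm hm' (by simpa using e)))
  refine ⟨hsymm, ?_, ?_, ?_⟩
  · intro i j hij
    rcases hex i j hij with ⟨rfl, _⟩ | ⟨k, l, h, hm, hc⟩
    · omega
    · have := hadd k l h hm
      rcases hc with ⟨rfl, rfl⟩ | ⟨rfl, rfl⟩ <;> omega
  · intro i j k hij hik
    rcases hex i j hij with ⟨rfl, hi⟩ | ⟨a, b, hab, hm, hc⟩ <;>
      rcases hex i k hik with ⟨rfl, hi'⟩ | ⟨a', b', hab', hm', hc'⟩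
    · rfl
    · have := hla i a' b' hab' hi hm'
      grind
    · have := hla i a b hab hi' hm
      grind
    · have := haa a b a' b' hab hab' hm hm'
      have := hab.ne
      grind
  · intro i hi
    rcases hD.exists_mem i with hm | ⟨j, k, h, hm, hc⟩
    · refine ⟨i, ?_⟩
      rw [quadPart_self, canonicalForm_rootVec h2, if_pos hm]
      -- The exceptional root `2ε_n` does not occur here, since `i` is not the last index.
      refine mul_ne_zero h2 (hξ _ hm fun k hk e => ?_)
      cases e; omega
    · have hne : quadPart (canonicalForm D ξ) j k ≠ 0 := by
        rw [quadPart_of_lt _ h, canonicalForm_rootVec h2, if_pos hm]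
        exact hξ _ hm fun _ _ e => by cases e
      rcases hc with rfl | rfl
      · exact ⟨k, hne⟩
      · exact ⟨j, by rwa [hsymm.apply]⟩

/-- The coefficients of the canonical form with a given canonical matrix. -/
def canonicalCoeff (Q : Matrix (Fin n) (Fin n) F) : PosRoot n → F
  | .long i => Q i i / 2
  | .sub _ _ _ => 0
  | .add i j _ => Q i j

/-- The roots of the canonical form with a given canonical matrix. -/
def canonicalSupport (Q : Matrix (Fin n) (Fin n) F) : Set (PosRoot n)
  | .long i => Q i i ≠ 0 ∨ ∀ j, Q i j = 0
  | .sub _ _ _ => False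
  | .add i j _ => Q i j ≠ 0

instance : Finite (PosRoot n) := by
  let φ : PosRoot n → Fin 3 × Fin n × Fin n := fun
    | .long i => (0, i, i)
    | .sub i j _ => (1, i, j)
    | .add i j _ => (2, i, j)
  refine Finite.of_injective φ ?_
  rintro (i | ⟨i, j, h⟩ | ⟨i, j, h⟩) (k | ⟨k, l, h'⟩ | ⟨k, l, h'⟩) e <;> simp_all [φ]

theorem IsCanonical.isOrthogonalSubset {Q : Matrix (Fin n) (Fin n) F} (hQ : IsCanonical Q)
    {D : Finset (PosRoot n)} (hD : (D : Set (PosRoot n)) = canonicalSupport Q) :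
    IsOrthogonalSubset D := by
  have hla : ∀ (i k l : Fin n) (h : k < l), .long i ∈ canonicalSupport Q → .add k l h ∈ canonicalSupport Q →
      (PosRoot.long i).Orthogonal (.add k l h) := by
    intro i k l h hi (hkl : Q k l ≠ 0)
    have hlk : Q l k ≠ 0 := by rwa [hQ.symm.apply]
    refine (orthogonal_long_add_iff h).2 ⟨?_, ?_⟩ <;> rintro rfl <;> rcases hi with hi | hi
    · exact h.ne (hQ.unique _ _ _ hi hkl)
    · exact hkl (hi l)
    · exact h.ne' (hQ.unique _ _ _ hi hlk)
    · exact hlk (hi k)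
  rw [IsOrthogonalSubset, hD]
  constructor
  · rintro (i | ⟨i, j, h⟩ | ⟨i, j, h⟩) hm
    · exact Or.inl ⟨i, rfl⟩
    · exact hm.elim
    · have h1 := hQ.near i j hm
      exact Or.inr ⟨i, j, h, by omega, rfl⟩
  · rintro (i | ⟨i, j, h⟩ | ⟨i, j, h⟩) hm (k | ⟨k, l, h'⟩ | ⟨k, l, h'⟩) hm' hne
    · exact orthogonal_long_long fun e => hne (by rw [e])
    · exact hm'.elim
    · exact hla _ _ _ _ hm hm'
    · exact hm.elim
    · exact hm.elim
    · exact hm.elim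
    · exact (hla _ _ _ _ hm' hm).symm
    · exact hm'.elim
    · have a1 : Q i j ≠ 0 := hm
      have a2 : Q k l ≠ 0 := hm'
      have a3 : Q j i ≠ 0 := by rwa [hQ.symm.apply]
      have a4 : Q l k ≠ 0 := by rwa [hQ.symm.apply]
      refine (orthogonal_add_add_iff h h').2 ⟨?_, ?_, ?_, ?_⟩ <;> rintro rfl
      · exact hne (by simp [hQ.unique _ _ _ a1 a2])
      · have := hQ.unique _ _ _ a1 a4
        subst this
        exact lt_asymm h h'
      · have := hQ.unique _ _ _ a3 a2
        subst this
        exact lt_asymm h h'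
      · exact hne (by simp [hQ.unique _ _ _ a3 a4])

/-- Every index occurs in some root of the support; a zero row, possible only for the last index,
contributes its long root for this reason. A further root of `D_reg` would share an index with a
root of the support without being orthogonal to it. -/
theorem IsCanonical.isMaximalOrthogonal {Q : Matrix (Fin n) (Fin n) F} (hQ : IsCanonical Q)
    {D : Finset (PosRoot n)} (hD : (D : Set (PosRoot n)) = canonicalSupport Q) :
    IsMaximalOrthogonal D := by
  refine ⟨hQ.isOrthogonalSubset hD, fun E hE hDE β hβ => ?_⟩
  have hmem : ∀ γ, γ ∈ canonicalSupport Q → γ ∈ D := fun γ hγ => by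
    rwa [← Finset.mem_coe, hD]
  have horth : ∀ γ, γ ∈ canonicalSupport Q → γ = β ∨ γ.Orthogonal β := fun γ hγ =>
    (eq_or_ne γ β).imp_right fun hne => hE.2 (hDE (hmem γ hγ)) hβ hne
  by_contra hβD
  have hβQ : β ∉ canonicalSupport Q := fun h => hβD (hmem β h)
  rcases hE.1 hβ with ⟨i, rfl⟩ | ⟨i, j, h, hij, rfl⟩
  · have h1 : ¬ (Q i i ≠ 0 ∨ ∀ j, Q i j = 0) := hβQ
    push Not at h1
    obtain ⟨h0, j, hj⟩ := h1
    rcases lt_trichotomy i j with h | rfl | h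
    · rcases horth (.add i j h) hj with e | e
      · cases e
      · exact ((orthogonal_long_add_iff h).1 e.symm).1 rfl
    · exact hj h0
    · rcases horth (.add j i h) (show Q j i ≠ 0 by rwa [hQ.symm.apply]) with e | e
      · cases e
      · exact ((orthogonal_long_add_iff h).1 e.symm).2 rfl
  · obtain ⟨k, hk⟩ := hQ.nonzero i (by omega)
    rcases lt_trichotomy i k with h' | rfl | h'
    · rcases horth (.add i k h') hk with e | e
      · exact hβQ (e ▸ hk)
      · exact ((orthogonal_add_add_iff h' h).1 e).1 rfl
    · rcases horth (.long i) (Or.inl hk) with e | e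
      · cases e
      · exact ((orthogonal_long_add_iff h).1 e).1 rfl
    · have hk' : Q k i ≠ 0 := by rwa [hQ.symm.apply]
      rcases horth (.add k i h') hk' with e | e
      · cases e
        exact lt_irrefl _ h
      · exact ((orthogonal_add_add_iff h' h).1 e).2.2.1 rfl

theorem IsCanonical.exists_canonicalForm (h2 : (2 : F) ≠ 0) {Q : Matrix (Fin n) (Fin n) F}
    (hQ : IsCanonical Q) : ∃ (D : Finset (PosRoot n)) (ξ : PosRoot n → F),
      IsMaximalOrthogonal D ∧ IsAdmissible D ξ ∧ quadPart (canonicalForm D ξ) = Q := by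
  classical
  have hD : (((canonicalSupport Q).toFinite.toFinset : Finset (PosRoot n)) : Set (PosRoot n)) =
      canonicalSupport Q := Set.Finite.coe_toFinset _
  set D := (canonicalSupport Q).toFinite.toFinset
  have hmem : ∀ β, β ∈ D ↔ β ∈ canonicalSupport Q := fun β => by rw [← Finset.mem_coe, hD]
  refine ⟨D, canonicalCoeff Q, hQ.isMaximalOrthogonal hD, ?_, ?_⟩
  · intro β hβ hlast
    rw [hmem] at hβ
    rcases β with i | ⟨i, j, h⟩ | ⟨i, j, h⟩
    · rcases hβ with hi | hi
      · exact div_ne_zero hi h2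
      · by_cases hin : (i : ℕ) + 1 = n
        · exact absurd rfl (hlast i hin)
        · obtain ⟨j, hj⟩ := hQ.nonzero i (by omega)
          exact absurd (hi j) hj
    · exact hβ.elim
    · exact hβ
  · have hlt : ∀ i j, i < j → quadPart (canonicalForm D (canonicalCoeff Q)) i j = Q i j := by
      intro i j h
      rw [quadPart_of_lt _ h, canonicalForm_rootVec h2]
      split_ifs with hm <;> rw [hmem] at hm
      · rfl
      · exact (not_not.1 hm).symm
    ext i j
    rcases lt_trichotomy i j with h | rfl | h
    · exact hlt i j h
    · rw [quadPart_self, canonicalForm_rootVec h2]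
      split_ifs with hm <;> rw [hmem] at hm
      · exact mul_div_cancel₀ _ h2
      · have : ¬ (Q i i ≠ 0 ∨ ∀ j, Q i j = 0) := hm
        push Not at this
        rw [this.1, mul_zero]
    · rw [← (quadPart_isSymm _).apply, hlt j i h, hQ.symm.apply]

theorem isCanonical_one : IsCanonical (1 : Matrix (Fin n) (Fin n) F) where
  symm := transpose_one
  near i j h := by
    obtain rfl : i = j := by by_contra hne; exact h (Matrix.one_apply_ne hne)
    omega
  unique i j k h h' := by
    obtain rfl : i = j := by by_contra hne; exact h (Matrix.one_apply_ne hne)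
    by_contra hne
    exact h' (Matrix.one_apply_ne hne)
  nonzero i _ := ⟨i, by simp⟩

theorem HasDim.unique [Finite F] {Ω : Set (Module.Dual F (nilp F n))} {d d' : ℕ}
    (h : HasDim Ω d) (h' : HasDim Ω d') : d = d' :=
  Nat.pow_right_injective (Finite.one_lt_card (α := F)) (Eq.trans (Eq.symm h) h')

/-- Besides the upper bound `n(n-1)`, this requires that the bound is attained by some orbit. -/
theorem isMaxDimOrbit_coadjointOrbit_iff [Finite F] (h2 : (2 : F) ≠ 0)
    (f : Module.Dual F (nilp F n)) :
    IsMaxDimOrbit (coadjointOrbit f) ↔ IsRegular (quadPart f) := by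
  rw [← finrank_range_kirillovForm_eq_iff h2]
  constructor
  · rintro ⟨-, d, hd, hmax⟩
    rw [(hasDim_coadjointOrbit h2 f).unique hd]
    -- The identity matrix is canonical, hence regular, and provides an orbit of dimension `n(n-1)`.
    obtain ⟨D, ξ, -, -, hQ⟩ := (isCanonical_one (F := F) (n := n)).exists_canonicalForm h2
    have h1 : IsRegular (quadPart (canonicalForm D ξ)) := hQ ▸ isCanonical_one.isRegular h2
    rw [← finrank_range_kirillovForm_eq_iff h2] at h1
    have h3 := hmax _ ⟨canonicalForm D ξ, rfl⟩ _ (hasDim_coadjointOrbit h2 _)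
    have h4 := finrank_range_kirillovForm_le h2 f
    rw [(hasDim_coadjointOrbit h2 f).unique hd] at h4
    omega
  · intro h
    refine ⟨⟨f, rfl⟩, _, hasDim_coadjointOrbit h2 f, ?_⟩
    rintro _ ⟨f', rfl⟩ d' hd'
    rw [hd'.unique (hasDim_coadjointOrbit h2 f'), h]
    exact finrank_range_kirillovForm_le h2 f'

end CanonicalForms
end TypeC

theorem theorem4p5 {F : Type*} [Field F] [Finite F] (hF : ringChar F ≠ 2) (n : ℕ) (hn : 1 ≤ n) :
    -- every coadjoint orbit has a dimension, which is at most `n (n - 1)`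
    (∀ Ω : Set (Module.Dual F (TypeC.nilp F n)), TypeC.IsCoadjointOrbit Ω →
      ∃ d ≤ n * (n - 1), TypeC.HasDim Ω d) ∧
    -- the orbits of the canonical forms have dimension `n (n - 1)`, the maximal one
    (∀ (D : Finset (TypeC.PosRoot n)) (ξ : TypeC.PosRoot n → F),
      TypeC.IsMaximalOrthogonal D → TypeC.IsAdmissible D ξ →
        TypeC.HasDim (TypeC.coadjointOrbit (TypeC.canonicalForm D ξ)) (n * (n - 1)) ∧
        TypeC.IsMaxDimOrbit (TypeC.coadjointOrbit (TypeC.canonicalForm D ξ))) ∧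
    -- each orbit of maximal dimension contains exactly one canonical form
    (∀ Ω : Set (Module.Dual F (TypeC.nilp F n)), TypeC.IsMaxDimOrbit Ω →
      ∃! f : Module.Dual F (TypeC.nilp F n), f ∈ Ω ∧
        ∃ (D : Finset (TypeC.PosRoot n)) (ξ : TypeC.PosRoot n → F),
          TypeC.IsMaximalOrthogonal D ∧ TypeC.IsAdmissible D ξ ∧
            f = TypeC.canonicalForm D ξ) := by
  have h2 : (2 : F) ≠ 0 := Ring.two_ne_zero hF
  refine ⟨?_, ?_, ?_⟩
  · rintro _ ⟨f, rfl⟩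
    exact ⟨_, TypeC.finrank_range_kirillovForm_le h2 f, TypeC.hasDim_coadjointOrbit h2 f⟩
  · intro D ξ hD hξ
    have h := (TypeC.isCanonical_quadPart h2 hD hξ).isRegular h2
    refine ⟨?_, (TypeC.isMaxDimOrbit_coadjointOrbit_iff h2 _).2 h⟩
    rw [← (TypeC.finrank_range_kirillovForm_eq_iff h2 _).2 h]
    exact TypeC.hasDim_coadjointOrbit h2 _
  · rintro _ hΩ
    obtain ⟨f, rfl⟩ := hΩ.1
    have hreg := (TypeC.isMaxDimOrbit_coadjointOrbit_iff h2 f).1 hΩ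
    obtain ⟨a, ha, hc⟩ := hreg.exists_isCanonical h2 (TypeC.quadPart_isSymm f)
    obtain ⟨D, ξ, hD, hξ, hQ⟩ := hc.exists_canonicalForm h2
    have hmem := TypeC.mem_coadjointOrbit_of_congruent h2 hreg ha hQ
    refine ⟨_, ⟨hmem, D, ξ, hD, hξ, rfl⟩, ?_⟩
    rintro _ ⟨hmem', D', ξ', hD', hξ', rfl⟩
    -- Two canonical forms in one orbit have congruent canonical matrices; these are equal, and they
    -- determine the forms.
    rw [← TypeC.coadjointOrbit_eq_of_mem hmem] at hmem'
    obtain ⟨b, hb, hb'⟩ := TypeC.exists_quadPart_eq_of_mem hmem'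
    refine TypeC.canonicalForm_ext h2 hD'.1 hD.1 ?_
    rw [hb']
    exact (TypeC.isCanonical_quadPart h2 hD hξ).eq_of_congruent hb
      (hb' ▸ TypeC.isCanonical_quadPart h2 hD' hξ')
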